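/- Let $\mathbb T=\mathbb R/\mathbb Z$ with its usual distance $|x-y|$. For a complex Borel measure $\mu$ on $\mathbb T$ let $|\mu|$ be its variation, $\|\mu\|=|\mu|(\mathbb T)$, $\hat\mu(m)=\int_{\mathbb T}e^{-2\pi imx}\,d\mu(x)$, and $P_M\mu(x)=\sum_{m=-M}^{M}\hat\mu(m)e^{2\pi imx}$. For $\epsilon\in\mathbb R$, say that $\mu$ is an $(\epsilon,\Lambda_M)$-approximation of $\mu_0$ if $\|\mu\|\le\|\mu_0\|+2\epsilon$ and $\|P_M(\mu-\mu_0)\|_{L^2(\mathbb T)}\le 2\epsilon$. There exists an absolute constant $C>0$ such that the following holds. Let $M\ge 128$ be an integer, let $\mu_0$ be a discrete complex measure on $\mathbb T$ whose support $S=\{s_j\}_{j=1}^J$ satisfies $|s_j-s_k|\ge 2/M$ for all $j\ne k$, and let $\mu$ be a complex measure on $\mathbb T$ that is an $(\epsilon,\Lambda_M)$-approximation of $\mu_0$. Put $S_M(j)=\{x\in\mathbb T:|x-s_j|\le 0.16\,M^{-1}\}$ and $S_M=\bigcup_{j=1}^J S_M(j)$. Then $$\int_{\mathbb T\setminus S_M}d|\mu-\mu_0|\le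 C\epsilon\qquad\text{and}\qquad \sum_{j=1}^J\int_{S_M(j)}|x-s_j|^2\,d|\mu-\mu_0|(x)\le C M^{-2}\epsilon.$$ -/

import Mathlib

open MeasureTheory

noncomputable section

namespace SuperResolution

/-- The torus `𝕋 = ℝ/ℤ`, with its quotient metric `dist x y = min_{k ∈ ℤ} |x - y - k|`. -/
abbrev Torus : Type := UnitAddCircle

/-- A complex measure has finite total variation, so the real-valued quantities below that are
built from `μ.variation` are the genuine ones. -/
instance isFiniteMeasure_variation {X : Type*} [MeasurableSpace X] (μ : ComplexMeasure X) :
    IsFiniteMeasure μ.variation := by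
  have hfin : ∀ σ : SignedMeasure X, IsFiniteMeasure σ.variation := fun σ => by
    rw [← SignedMeasure.totalVariation_eq_variation]
    unfold SignedMeasure.totalVariation
    infer_instance
  have h1 := hfin (ComplexMeasure.re μ)
  have h2 := hfin (ComplexMeasure.im μ)
  refine isFiniteMeasure_of_le
    ((ComplexMeasure.re μ).variation + (ComplexMeasure.im μ).variation) ?_
  refine VectorMeasure.variation_le_of_forall_enorm_le fun E _ => ?_
  rw [Measure.add_apply]
  refine le_trans ?_ (add_le_add
    (VectorMeasure.enorm_measure_le_variation (ComplexMeasure.re μ) E)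
    (VectorMeasure.enorm_measure_le_variation (ComplexMeasure.im μ) E))
  rw [← ofReal_norm, ← ofReal_norm, ← ofReal_norm,
    ← ENNReal.ofReal_add (norm_nonneg _) (norm_nonneg _)]
  exact ENNReal.ofReal_le_ofReal (Complex.norm_le_abs_re_add_abs_im (μ E))

/-- The total variation norm `‖μ‖ = |μ|(𝕋)`. -/
def tvNorm (μ : ComplexMeasure Torus) : ℝ := μ.variation.real Set.univ

/-- The Fourier coefficient `μ̂(m) = ∫ e^{-2πimx} dμ(x)`. -/
def fourierCoeff (μ : ComplexMeasure Torus) (m : ℤ) : ℂ :=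
  VectorMeasure.integral μ (fun x : Torus => (fourier (-m) x : ℂ)) (ContinuousLinearMap.mul ℝ ℂ)

/-- The projection `P_M μ (x) = ∑_{m=-M}^{M} μ̂(m) e^{2πimx}`. -/
def proj (M : ℕ) (μ : ComplexMeasure Torus) (x : Torus) : ℂ :=
  ∑ m ∈ Finset.Icc (-(M : ℤ)) (M : ℤ), fourierCoeff μ m * fourier m x

/-- The norm of `L²(𝕋)`, with respect to the Haar probability measure. -/
def l2Norm (f : Torus → ℂ) : ℝ := (eLpNorm f 2 AddCircle.haarAddCircle).toReal

/-- The (closed) support of a complex measure: the complement of the largest open `|μ|`-null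
set. -/
def support (μ : ComplexMeasure Torus) : Set Torus := μ.variation.support

/-- Discrete measures: those carried by a countable set, i.e. the sums of countably many point
masses. -/
def IsDiscrete (μ : ComplexMeasure Torus) : Prop :=
  ∃ D : Set Torus, D.Countable ∧ μ.variation Dᶜ = 0

/-- The `Λ_M`-minimum separation condition: distinct points are at distance at least `2/M`. -/
def IsMinSeparated (M : ℕ) (S : Set Torus) : Prop :=
  ∀ s ∈ S, ∀ t ∈ S, s ≠ t → 2 / (M : ℝ) ≤ dist s t

/-- The class `M(𝕋; Λ_M)` of discrete measures whose support satisfies the `Λ_M`-minimum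
separation condition. -/
def separatedMeasures (M : ℕ) : Set (ComplexMeasure Torus) :=
  {μ | IsDiscrete μ ∧ IsMinSeparated M (support μ)}

/-- `μ` is an `(ε, Λ_M)`-approximation of `μ₀`. -/
def IsApproximation (ε : ℝ) (M : ℕ) (μ μ₀ : ComplexMeasure Torus) : Prop :=
  tvNorm μ ≤ tvNorm μ₀ + 2 * ε ∧ l2Norm (proj M (μ - μ₀)) ≤ 2 * ε

/-- The neighbourhood `{x : |x - s| ≤ 0.16 / M}` of a point `s`. -/
def nearPoint (M : ℕ) (s : Torus) : Set Torus := {x | dist x s ≤ 0.16 / (M : ℝ)}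

/-- The union `S_M` of the neighbourhoods of the points of `S`. -/
def nearSet (M : ℕ) (S : Finset Torus) : Set Torus := ⋃ s ∈ S, nearPoint M s

end SuperResolution

end

/-! The proof is by duality. Write ν = μ - μ₀ and choose phases v with v(s) ν{s} = |ν{s}| on S.
Suppose a trigonometric polynomial q of degree M equals v on S and satisfies |q| ≤ 1 - g with g ≥ 0.
Since q only sees frequencies up to M, |∫ q dν| ≤ ‖P_M ν‖₂ ≤ 2ε, so |ν|(S) ≤ 2ε + |ν|(Sᶜ) - ∫_{Sᶜ} g
d|ν|. On the other hand μ₀ lives on S, and the bound on ‖μ‖ gives |ν|(Sᶜ) ≤ 2ε + |ν|(S). Adding,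
∫_{Sᶜ} g d|ν| ≤ 4ε (`setIntegral_le_of_dual`). Both claims follow once g is comparable to M²|x - s|²
near each node s and bounded below by a positive constant elsewhere (`gap`).

To build q (`exists_dual_polynomial`), put N = ⌈M/2⌉ and rescale by u = N x, so that nodes are at
mutual distance at least 1. Take q = ∑ α_t K(x - t) + β_t H(x - t), where K is the Jackson kernel
and H = K · N sin(2πu/N)/(2π); the degree is at most 2N - 1 ≤ M. At the origin K = 1, K' = 0, H = 0,
H' = 1, so the conditions q = v, q' = 0 on S are a perturbation of the identity. Fourth-power decay
of K and cubic decay of H make the off-diagonal row sums small, so the system is solvable with α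
close to v and β small (`exists_coeffs`).

Near a node the quadratic drop of K beats the second order Taylor remainder of the other terms
(`norm_kernelSum_le_near`). Away from the nodes at most two terms are large, and the rest is a cubic
tail (`norm_kernelSum_le_far`). -/

namespace SuperResolution

/-! ### Pairing trigonometric polynomials with complex measures -/

/-- The integral of a complex function against a complex measure. -/
noncomputable abbrev cintegral (ν : ComplexMeasure Torus) (f : Torus → ℂ) : ℂ :=
  VectorMeasure.integral ν f (ContinuousLinearMap.mul ℝ ℂ)

/-- The pairing is only ℝ-bilinear, so complex homogeneity has to come from associativity of
multiplication in ℂ. -/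
lemma cintegral_const_mul (ν : ComplexMeasure Torus) (c : ℂ) (f : Torus → ℂ) :
    cintegral ν (fun x => c * f x) = c * cintegral ν f := by
  refine setToFun_smul (𝕜 := ℂ) _ (fun c s x => ?_) c f
  rw [transpose_eq_cbmApplyMeasure]
  simp only [cbmApplyMeasure_apply, ContinuousLinearMap.mul_apply', smul_eq_mul,
    mul_assoc]

lemma integrable_of_continuous (ν : Measure Torus) [IsFiniteMeasure ν] {f : Torus → ℂ}
    (hf : Continuous f) : Integrable f ν :=
  integrableOn_univ.1 (hf.continuousOn.integrableOn_compact isCompact_univ)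

/-- The trigonometric polynomial of degree at most `M` with coefficients `c`. -/
noncomputable def trigSum (M : ℕ) (c : ℤ → ℂ) (x : Torus) : ℂ :=
  ∑ m ∈ Finset.Icc (-(M : ℤ)) (M : ℤ), c m * fourier m x

lemma continuous_trigSum (M : ℕ) (c : ℤ → ℂ) : Continuous (trigSum M c) := by
  unfold trigSum; fun_prop

lemma cintegral_trigSum (ν : ComplexMeasure Torus) (M : ℕ) (c : ℤ → ℂ) :
    cintegral ν (trigSum M c) =
      ∑ m ∈ Finset.Icc (-(M : ℤ)) (M : ℤ), c m * fourierCoeff ν (-m) := by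
  have : trigSum M c = fun x => ∑ m ∈ Finset.Icc (-(M : ℤ)) (M : ℤ), c m * fourier m x := rfl
  rw [this, cintegral, VectorMeasure.integral_finsetSum]
  · refine Finset.sum_congr rfl fun m _ => ?_
    rw [← cintegral, cintegral_const_mul, fourierCoeff, neg_neg]
  · intro m _
    exact integrable_of_continuous _ (by fun_prop)

lemma integral_fourier_mul_fourier (m n : ℤ) :
    ∫ x : Torus, fourier m x * fourier n x ∂AddCircle.haarAddCircle = if m = -n then 1 else 0 := by
  have h := congrFun (fourierCoeff_fourier (T := 1) n) (-m)
  rw [_root_.fourierCoeff] at h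
  simp only [neg_neg, smul_eq_mul] at h
  rw [h, Pi.single_apply]
  simp [neg_eq_iff_eq_neg]

/-- Parseval in bilinear form: without conjugation, frequency m pairs with -m. -/
lemma integral_trigSum_mul_trigSum (M : ℕ) (c d : ℤ → ℂ) :
    ∫ x, trigSum M c x * trigSum M d x ∂AddCircle.haarAddCircle =
      ∑ m ∈ Finset.Icc (-(M : ℤ)) (M : ℤ), c m * d (-m) := by
  have hi : ∀ m n : ℤ, Integrable (fun x : Torus => c m * d n * (fourier m x * fourier n x))
      AddCircle.haarAddCircle := fun m n => integrable_of_continuous _ (by fun_prop)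
  have : ∀ x, trigSum M c x * trigSum M d x =
      ∑ m ∈ Finset.Icc (-(M : ℤ)) (M : ℤ), ∑ n ∈ Finset.Icc (-(M : ℤ)) (M : ℤ),
        c m * d n * (fourier m x * fourier n x) := fun x => by
    rw [trigSum, trigSum, Finset.sum_mul_sum]
    exact Finset.sum_congr rfl fun m _ => Finset.sum_congr rfl fun n _ => by ring
  simp only [this]
  rw [integral_finsetSum _ fun m _ => integrable_finsetSum _ fun n _ => hi m n]
  refine Finset.sum_congr rfl fun m hm => ?_
  rw [integral_finsetSum _ fun n _ => hi m n, Finset.sum_eq_single (-m)]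
  · rw [integral_const_mul, integral_fourier_mul_fourier]; simp
  · intro n _ hn
    rw [integral_const_mul, integral_fourier_mul_fourier, if_neg, mul_zero]
    rintro rfl; simp at hn
  · intro h
    simp only [Finset.mem_Icc] at hm h
    omega

/-- By Parseval the integral against ν is the Haar integral against P_M ν; then L¹ ≤ L², Haar
measure being a probability. -/
lemma norm_cintegral_trigSum_le (ν : ComplexMeasure Torus) (M : ℕ) (c : ℤ → ℂ)
    (hc : ∀ x, ‖trigSum M c x‖ ≤ 1) :
    ‖cintegral ν (trigSum M c)‖ ≤ l2Norm (proj M ν) := by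
  have hp : proj M ν = trigSum M (fourierCoeff ν) := rfl
  have hcont := continuous_trigSum M (fourierCoeff ν)
  rw [cintegral_trigSum, ← integral_trigSum_mul_trigSum, hp, l2Norm]
  refine (norm_integral_le_integral_norm _).trans ?_
  have h1 : ∫ x, ‖trigSum M c x * trigSum M (fourierCoeff ν) x‖ ∂AddCircle.haarAddCircle ≤
      ∫ x, ‖trigSum M (fourierCoeff ν) x‖ ∂AddCircle.haarAddCircle := by
    refine integral_mono (integrable_of_continuous _
      ((continuous_trigSum M c).mul hcont)).norm (integrable_of_continuous _ hcont).norm fun x => ?_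
    dsimp only
    rw [norm_mul]
    exact mul_le_of_le_one_left (norm_nonneg _) (hc x)
  refine h1.trans ?_
  have hmem : MemLp (trigSum M (fourierCoeff ν)) 2 (AddCircle.haarAddCircle (T := 1)) := by
    refine MemLp.of_bound hcont.aestronglyMeasurable
      (∑ m ∈ Finset.Icc (-(M : ℤ)) (M : ℤ), ‖fourierCoeff ν m‖) (Filter.Eventually.of_forall ?_)
    intro x
    refine (norm_sum_le _ _).trans (Finset.sum_le_sum fun m _ => ?_)
    rw [norm_mul, fourier_apply, Circle.norm_coe, mul_one]
  rw [integral_norm_eq_lintegral_enorm hcont.aestronglyMeasurable, ← eLpNorm_one_eq_lintegral_enorm]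
  exact ENNReal.toReal_mono hmem.eLpNorm_ne_top
    (eLpNorm_le_eLpNorm_of_exponent_le (by norm_num) hcont.aestronglyMeasurable)

/-! ### Values of a complex measure on a finite set -/

lemma setIntegral_finset (ν : ComplexMeasure Torus) (S : Finset Torus) (f : Torus → ℂ)
    (hf : Continuous f) :
    cintegral (ν.restrict (S : Set Torus)) f = ∑ s ∈ S, f s * ν {s} := by
  have hU : (S : Set Torus) = ⋃ s ∈ S, {s} := by ext; simp
  have hi : ∀ s ∈ S, ν.IntegrableOn f {s} := fun s _ =>
    VectorMeasure.Integrable.integrableOn (integrable_of_continuous _ hf)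
  rw [cintegral, hU, VectorMeasure.setIntegral_biUnion_finset S
    (fun s _ => measurableSet_singleton s)
    (fun s _ t _ hst => by simpa [Function.onFun] using hst) hi]
  refine Finset.sum_congr rfl fun s _ => ?_
  rw [VectorMeasure.setIntegral_congr_fun (g := fun _ => f s) (by intro x hx; simp_all)]
  rw [VectorMeasure.integral_const]
  simp

lemma variation_real_finset (ν : ComplexMeasure Torus) (S : Finset Torus) :
    ν.variation.real (S : Set Torus) = ∑ s ∈ S, ‖ν {s}‖ := by
  rw [measureReal_def, ← MeasureTheory.sum_measure_singleton, ENNReal.toReal_sum (by simp)]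
  refine Finset.sum_congr rfl fun s _ => ?_
  rw [← toReal_enorm]
  congr 1
  refine le_antisymm ?_ (VectorMeasure.enorm_measure_le_variation ν {s})
  -- The variation is the least measure dominating ‖ν E‖, and the only subsets of {s} to test are ∅
  -- and {s}.
  have h := VectorMeasure.variation_apply_le_of_forall_enorm_le (μ := ν)
    (m := ‖ν {s}‖ₑ • Measure.dirac s) (measurableSet_singleton s) ?_
  · simpa using h
  · intro E _ hE
    rcases Set.subset_singleton_iff_eq.1 hE with rfl | rfl
    · simp
    · simp

lemma exists_phase (z : ℂ) : ∃ v : ℂ, ‖v‖ ≤ 1 ∧ v * z = ‖z‖ := by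
  by_cases hz : z = 0
  · exact ⟨0, by simp, by simp [hz]⟩
  · have hn : (‖z‖ : ℂ) ≠ 0 := by simpa using hz
    refine ⟨(starRingEnd ℂ) z / ‖z‖, ?_, ?_⟩
    · rw [norm_div, RCLike.norm_conj, Complex.norm_real, norm_norm, div_self (by simpa using hz)]
    · rw [div_mul_eq_mul_div, mul_comm, Complex.mul_conj, Complex.normSq_eq_norm_sq]
      field_simp
      push_cast
      ring

/-- If unimodular data on the support of `μ₀` can be interpolated by trigonometric polynomials of
degree `M` bounded by `1 - g`, then `g` has a small integral against `|μ - μ₀|`. -/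
theorem setIntegral_le_of_dual {M : ℕ} {ε : ℝ} {μ₀ μ : ComplexMeasure Torus} {S : Finset Torus}
    (hS : (S : Set Torus) = support μ₀) (happ : IsApproximation ε M μ μ₀) {g : Torus → ℝ}
    (hg : Measurable g) (hg0 : ∀ x, 0 ≤ g x)
    (hdual : ∀ v : Torus → ℂ, (∀ s, ‖v s‖ ≤ 1) → ∃ c : ℤ → ℂ,
      (∀ s ∈ S, trigSum M c s = v s) ∧ ∀ x, ‖trigSum M c x‖ ≤ 1 - g x) :
    ∫ x in (S : Set Torus)ᶜ, g x ∂(μ - μ₀).variation ≤ 4 * ε := by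
  set ν := μ - μ₀ with hν
  have hSm : MeasurableSet (S : Set Torus) := S.measurableSet
  choose v hv1 hv using fun s : Torus => exists_phase (ν {s})
  obtain ⟨c, hcS, hc⟩ := hdual v hv1
  have hg1 : ∀ x, g x ≤ 1 := fun x => by linarith [hc x, norm_nonneg (trigSum M c x)]
  have hgi : Integrable g (ν.variation.restrict (S : Set Torus)ᶜ) :=
    Integrable.of_bound hg.aestronglyMeasurable 1
      (Filter.Eventually.of_forall fun x => by rw [Real.norm_of_nonneg (hg0 x)]; exact hg1 x)
  have hcont := continuous_trigSum M c
  have hsplit := VectorMeasure.setIntegral_add_compl (μ := ν) (f := trigSum M c)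
    (B := ContinuousLinearMap.mul ℝ ℂ) hSm (integrable_of_continuous _ hcont)
  -- By the choice of phases, q collects the full mass of ν on S.
  have h1 : cintegral (ν.restrict (S : Set Torus)) (trigSum M c) =
      ((ν.variation.real (S : Set Torus) : ℝ) : ℂ) := by
    rw [setIntegral_finset _ _ _ hcont, variation_real_finset]
    push_cast
    exact Finset.sum_congr rfl fun s hs => by rw [hcS s hs, hv s]
  have h2 : ‖cintegral (ν.restrict (S : Set Torus)ᶜ) (trigSum M c)‖ ≤
      ν.variation.real (S : Set Torus)ᶜ - ∫ x in (S : Set Torus)ᶜ, g x ∂ν.variation := by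
    refine (VectorMeasure.norm_integral_le_integral_norm).trans ?_
    rw [VectorMeasure.variation_restrict hSm.compl]
    have hB : ‖ContinuousLinearMap.mul ℝ ℂ‖ ≤ 1 := ContinuousLinearMap.opNorm_mul_le ℝ ℂ
    have hnn : 0 ≤ ∫ x in (S : Set Torus)ᶜ, ‖trigSum M c x‖ ∂ν.variation :=
      integral_nonneg fun _ => norm_nonneg _
    refine (mul_le_of_le_one_left hnn hB).trans ?_
    refine (integral_mono (integrable_of_continuous _ hcont).norm
      ((integrable_const (1 : ℝ)).sub hgi) hc).trans_eq ?_
    rw [integral_sub' (integrable_const 1) hgi]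
    simp [measureReal_def]
  have h3 : ‖cintegral ν (trigSum M c)‖ ≤ 2 * ε :=
    (norm_cintegral_trigSum_le ν M c fun x => by linarith [hc x, hg0 x]).trans happ.2
  have h4 : ν.variation.real (S : Set Torus) ≤
      2 * ε + (ν.variation.real (S : Set Torus)ᶜ - ∫ x in (S : Set Torus)ᶜ, g x ∂ν.variation) := by
    have : (ν.variation.real (S : Set Torus)) =
        ‖cintegral (ν.restrict (S : Set Torus)) (trigSum M c)‖ := by
      rw [h1, Complex.norm_real, Real.norm_of_nonneg measureReal_nonneg]
    rw [this]
    have h5 : cintegral (ν.restrict (S : Set Torus)) (trigSum M c) = cintegral ν (trigSum M c) -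
        cintegral (ν.restrict (S : Set Torus)ᶜ) (trigSum M c) := eq_sub_of_add_eq hsplit
    rw [h5]
    exact (norm_sub_le _ _).trans (add_le_add h3 h2)
  have hμ₀ : μ₀.variation (S : Set Torus)ᶜ = 0 := by
    rw [hS]; exact Measure.measure_compl_support
  have h6 : ν.variation.real (S : Set Torus)ᶜ ≤ μ.variation.real (S : Set Torus)ᶜ := by
    refine ENNReal.toReal_mono (by finiteness) ?_
    refine (VectorMeasure.variation_sub_le _).trans ?_
    simp [hμ₀]
  have h7 : μ₀.variation.real (S : Set Torus) ≤
      μ.variation.real (S : Set Torus) + ν.variation.real (S : Set Torus) := by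
    simp only [variation_real_finset]
    rw [← Finset.sum_add_distrib]
    refine Finset.sum_le_sum fun s _ => ?_
    have : μ₀ {s} = μ {s} - ν {s} := by simp [hν]
    rw [this]
    exact norm_sub_le _ _
  have h8 := happ.1
  rw [tvNorm, tvNorm, ← measureReal_add_measureReal_compl hSm,
    ← measureReal_add_measureReal_compl (μ := μ₀.variation) hSm] at h8
  have h9 : μ₀.variation.real (S : Set Torus)ᶜ = 0 := by simp [measureReal_def, hμ₀]
  -- With `h6` to `h9`: |ν|(Sᶜ) ≤ |μ|(Sᶜ) ≤ ‖μ₀‖ + 2ε - |μ|(S) ≤ 2ε + |ν|(S). Adding `h4` cancels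
  -- both masses of ν.
  linarith

/-! ### The Jackson kernel and its companion in rescaled real coordinates -/

section Kernel

open Real

/-- The reciprocal `1 / (N sin (π u / N))`. -/
noncomputable def cosecScaled (N : ℕ) (u : ℝ) : ℝ := (N * sin (π * u / N))⁻¹

/-- The Jackson kernel `(sin (π u) / (N sin (π u / N)))⁴`. -/
noncomputable def jack (N : ℕ) (u : ℝ) : ℝ := sin (π * u) ^ 4 * cosecScaled N u ^ 4

/-- The derivative of `jack`. -/
noncomputable def jackDeriv (N : ℕ) (u : ℝ) : ℝ :=
  4 * π * (sin (π * u) ^ 3 * cos (π * u) * cosecScaled N u ^ 4 -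
    cos (π * u / N) * sin (π * u) ^ 4 * cosecScaled N u ^ 5)

/-- The second derivative of `jack`. -/
noncomputable def jackDeriv₂ (N : ℕ) (u : ℝ) : ℝ :=
  4 * π ^ 2 * cosecScaled N u ^ 4 * (3 * sin (π * u) ^ 2 * cos (π * u) ^ 2 -
    sin (π * u) ^ 4 * (1 + 4 * (N : ℝ)⁻¹ ^ 2 - 5 * cosecScaled N u ^ 2) -
    8 * cos (π * u / N) * cosecScaled N u * (sin (π * u) ^ 3 * cos (π * u)))

/-- The odd companion of the Jackson kernel, `jack N u * (N sin (2π u / N) / (2π))`. -/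
noncomputable def jackOdd (N : ℕ) (u : ℝ) : ℝ :=
  sin (π * u) ^ 4 * cosecScaled N u ^ 3 * cos (π * u / N) / π

/-- The derivative of `jackOdd`. -/
noncomputable def jackOddDeriv (N : ℕ) (u : ℝ) : ℝ :=
  4 * (sin (π * u) ^ 3 * cos (π * u)) * cosecScaled N u ^ 3 * cos (π * u / N) +
    sin (π * u) ^ 4 * (2 * cosecScaled N u ^ 2 * (N : ℝ)⁻¹ ^ 2 - 3 * cosecScaled N u ^ 4)

/-- The second derivative of `jackOdd`. -/
noncomputable def jackOddDeriv₂ (N : ℕ) (u : ℝ) : ℝ :=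
  4 * π * (cosecScaled N u ^ 3 * cos (π * u / N) * (3 * sin (π * u) ^ 2 * cos (π * u) ^ 2 -
    sin (π * u) ^ 4 * (1 + (N : ℝ)⁻¹ ^ 2 - 3 * cosecScaled N u ^ 2)) +
    sin (π * u) ^ 3 * cos (π * u) *
      (4 * cosecScaled N u ^ 2 * (N : ℝ)⁻¹ ^ 2 - 6 * cosecScaled N u ^ 4))

variable {N : ℕ} {u : ℝ}

lemma cosecScaled_mul_sin (h : sin (π * u / N) ≠ 0) :
    cosecScaled N u * sin (π * u / N) = (N : ℝ)⁻¹ := by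
  rw [cosecScaled, mul_inv, mul_assoc, inv_mul_cancel₀ h, mul_one]

lemma jackOdd_eq_mul (h : sin (π * u / N) ≠ 0) :
    jackOdd N u = jack N u * (N * (sin (π * u / N) * cos (π * u / N)) / π) := by
  have hN : (N : ℝ) ≠ 0 := by rintro h0; simp [h0] at h
  have e := cosecScaled_mul_sin h
  have e' : (N : ℝ) * (N : ℝ)⁻¹ = 1 := mul_inv_cancel₀ hN
  rw [← e] at e'
  simp only [jackOdd, jack]
  have hπ := pi_ne_zero
  field_simp
  linear_combination (-sin (π * u) ^ 4 * cosecScaled N u ^ 3 * cos (π * u / N)) * e'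

lemma hasDerivAt_sin_pi (u : ℝ) : HasDerivAt (fun u => sin (π * u)) (π * cos (π * u)) u := by
  have := ((hasDerivAt_id u).const_mul π).sin
  simpa [mul_comm] using this

lemma hasDerivAt_cos_pi (u : ℝ) : HasDerivAt (fun u => cos (π * u)) (-(π * sin (π * u))) u := by
  have := ((hasDerivAt_id u).const_mul π).cos
  simpa [mul_comm] using this

lemma hasDerivAt_cos_pi_div (N : ℕ) (u : ℝ) : HasDerivAt (fun u => cos (π * u / N))
    (-(π * (N : ℝ)⁻¹ * sin (π * u / N))) u := by
  have := (((hasDerivAt_id u).const_mul π).div_const (N : ℝ)).cos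
  refine this.congr_deriv ?_
  simp only [id]
  ring

/-- This rule keeps all derivatives polynomial in sin(πu), cos(πu), cos(πu/N), the weight w =
`cosecScaled N u` and 1/N. -/
lemma hasDerivAt_cosecScaled (h : sin (π * u / N) ≠ 0) :
    HasDerivAt (cosecScaled N) (-(π * cos (π * u / N) * cosecScaled N u ^ 2)) u := by
  have hN : (N : ℝ) ≠ 0 := by
    rintro h0; simp [h0] at h
  have h1 := ((((hasDerivAt_id u).const_mul π).div_const (N : ℝ)).sin.const_mul (N : ℝ)).inv
    (mul_ne_zero hN h)
  refine h1.congr_deriv ?_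
  simp only [cosecScaled, id]
  field_simp

lemma hasDerivAt_jack (h : sin (π * u / N) ≠ 0) :
    HasDerivAt (jack N) (jackDeriv N u) u := by
  have h1 := ((hasDerivAt_sin_pi u).fun_pow 4).fun_mul ((hasDerivAt_cosecScaled h).fun_pow 4)
  refine h1.congr_deriv ?_
  simp only [jackDeriv]
  push_cast
  ring

lemma hasDerivAt_jackDeriv (h : sin (π * u / N) ≠ 0) :
    HasDerivAt (jackDeriv N) (jackDeriv₂ N u) u := by
  have hw := hasDerivAt_cosecScaled h
  have h1 := (((((hasDerivAt_sin_pi u).fun_pow 3).fun_mul (hasDerivAt_cos_pi u)).fun_mul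
    (hw.fun_pow 4)).fun_sub (((hasDerivAt_cos_pi_div N u).fun_mul
      ((hasDerivAt_sin_pi u).fun_pow 4)).fun_mul (hw.fun_pow 5))).const_mul (4 * π)
  refine h1.congr_deriv ?_
  have e1 := cosecScaled_mul_sin h
  have e2 := sin_sq_add_cos_sq (π * u / N)
  simp only [jackDeriv₂]
  generalize sin (π * u / N) = σ at *
  generalize cos (π * u / N) = γ at *
  generalize sin (π * u) = p at *
  generalize cos (π * u) = c at *
  generalize cosecScaled N u = w at *
  -- Replacing 1/N by w σ leaves a polynomial identity modulo σ² + γ² = 1.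
  rw [← e1]
  push_cast
  linear_combination (20 * π ^ 2 * p ^ 4 * w ^ 6) * e2

lemma hasDerivAt_jackOdd (h : sin (π * u / N) ≠ 0) :
    HasDerivAt (jackOdd N) (jackOddDeriv N u) u := by
  have hw := hasDerivAt_cosecScaled h
  have h1 := ((((hasDerivAt_sin_pi u).fun_pow 4).fun_mul (hw.fun_pow 3)).fun_mul
    (hasDerivAt_cos_pi_div N u)).div_const π
  refine h1.congr_deriv ?_
  have e1 := cosecScaled_mul_sin h
  have e2 := sin_sq_add_cos_sq (π * u / N)
  have hπ := pi_ne_zero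
  rw [div_eq_iff hπ]
  simp only [jackOddDeriv]
  generalize sin (π * u / N) = σ at *
  generalize cos (π * u / N) = γ at *
  generalize sin (π * u) = p at *
  generalize cos (π * u) = c at *
  generalize cosecScaled N u = w at *
  rw [← e1]
  push_cast
  linear_combination (-3 * π * p ^ 4 * w ^ 4) * e2

lemma hasDerivAt_jackOddDeriv (h : sin (π * u / N) ≠ 0) :
    HasDerivAt (jackOddDeriv N) (jackOddDeriv₂ N u) u := by
  have hw := hasDerivAt_cosecScaled h
  have h1 := ((((((hasDerivAt_sin_pi u).fun_pow 3).fun_mul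
    (hasDerivAt_cos_pi u)).const_mul 4).fun_mul (hw.fun_pow 3)).fun_mul
      (hasDerivAt_cos_pi_div N u)).fun_add (((hasDerivAt_sin_pi u).fun_pow 4).fun_mul
      ((((hw.fun_pow 2).const_mul 2).mul_const ((N : ℝ)⁻¹ ^ 2)).fun_sub
        ((hw.fun_pow 4).const_mul 3)))
  refine h1.congr_deriv ?_
  have e1 := cosecScaled_mul_sin h
  have e2 := sin_sq_add_cos_sq (π * u / N)
  simp only [jackOddDeriv₂]
  generalize sin (π * u / N) = σ at *
  generalize cos (π * u / N) = γ at *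
  generalize sin (π * u) = p at *
  generalize cos (π * u) = c at *
  generalize cosecScaled N u = w at *
  rw [← e1]
  push_cast
  linear_combination (-12 * π * p ^ 3 * c * w ^ 4) * e2

/-- Lets the N⁻² corrections in the derivatives be absorbed by powers of the weight. -/
lemma sq_inv_le_cosecScaled_sq (h : sin (π * u / N) ≠ 0) :
    (N : ℝ)⁻¹ ^ 2 ≤ cosecScaled N u ^ 2 := by
  rw [← cosecScaled_mul_sin h, mul_pow]
  exact mul_le_of_le_one_right (sq_nonneg _) (sin_sq_le_one _)

lemma abs_sin_cube_mul_cos_le (x : ℝ) : |sin x ^ 3 * cos x| ≤ 0.325 := by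
  refine abs_le_of_sq_le_sq ?_ (by norm_num)
  have h := cos_sq' x
  have : (sin x ^ 3 * cos x) ^ 2 = (sin x ^ 2) ^ 3 * (1 - sin x ^ 2) := by rw [← h]; ring
  rw [this]
  generalize sin x ^ 2 = y
  -- The maximum of y³(1 - y) is 27/256, at y = 3/4, and 27/256 - y³ + y⁴ = (y - 3/4)²((y + 1/4)² +
  -- 1/8).
  nlinarith [mul_nonneg (sq_nonneg (y - 3 / 4))
    (add_nonneg (sq_nonneg (y + 1 / 4)) (by norm_num : (0 : ℝ) ≤ 1 / 8))]

lemma abs_trig_quadratic_le (x : ℝ) {E : ℝ} (h0 : 0 ≤ E) (h1 : E ≤ 1) :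
    |3 * sin x ^ 2 * cos x ^ 2 - sin x ^ 4 * E| ≤ 1 := by
  rw [cos_sq']
  have hy0 := sq_nonneg (sin x)
  have hy1 := sin_sq_le_one x
  have : sin x ^ 4 = (sin x ^ 2) ^ 2 := by ring
  rw [this]
  generalize sin x ^ 2 = y at *
  have h2 : y ^ 2 * E ≤ 1 := by
    calc y ^ 2 * E ≤ 1 * 1 := by gcongr; nlinarith
      _ = 1 := one_mul 1
  have h3 : 0 ≤ y ^ 2 * E := by positivity
  rw [abs_le]
  constructor <;> nlinarith [sq_nonneg (y - 1 / 2)]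

lemma abs_sin_pow_le_one (x : ℝ) (n : ℕ) : |sin x| ^ n ≤ 1 :=
  pow_le_one₀ (abs_nonneg _) (abs_sin_le_one _)

lemma abs_jack_le (N : ℕ) (u : ℝ) : |jack N u| ≤ |cosecScaled N u| ^ 4 := by
  rw [jack, abs_mul, abs_pow, abs_pow]
  exact mul_le_of_le_one_left (by positivity) (abs_sin_pow_le_one _ _)

lemma abs_jackOdd_le (N : ℕ) (u : ℝ) : |jackOdd N u| ≤ |cosecScaled N u| ^ 3 / π := by
  rw [jackOdd, abs_div, abs_of_pos pi_pos, abs_mul, abs_mul, abs_pow, abs_pow]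
  gcongr
  have h1 := abs_sin_pow_le_one (π * u) 4
  have h2 := abs_cos_le_one (π * u / N)
  calc _ ≤ 1 * |cosecScaled N u| ^ 3 * 1 := by gcongr
    _ = _ := by ring

lemma abs_jackDeriv_le (N : ℕ) (u : ℝ) :
    |jackDeriv N u| ≤ 4 * π * |cosecScaled N u| ^ 4 * (0.325 + |cosecScaled N u|) := by
  have h0 := abs_sin_cube_mul_cos_le (π * u)
  have h1 := abs_sin_pow_le_one (π * u) 4
  have h2 := abs_cos_le_one (π * u / N)
  rw [jackDeriv, abs_mul, abs_of_pos (by positivity : 0 < 4 * π)]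
  calc _ ≤ 4 * π * (|sin (π * u) ^ 3 * cos (π * u)| * |cosecScaled N u| ^ 4 +
        |cos (π * u / N)| * |sin (π * u)| ^ 4 * |cosecScaled N u| ^ 5) := by
        gcongr
        refine (abs_sub _ _).trans_eq ?_
        simp only [abs_mul, abs_pow]
    _ ≤ 4 * π * (0.325 * |cosecScaled N u| ^ 4 + 1 * 1 * |cosecScaled N u| ^ 5) := by gcongr
    _ = _ := by ring

lemma abs_jackOddDeriv_le (h : sin (π * u / N) ≠ 0) :
    |jackOddDeriv N u| ≤ 1.3 * |cosecScaled N u| ^ 3 + 3 * |cosecScaled N u| ^ 4 := by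
  have h0 := abs_sin_cube_mul_cos_le (π * u)
  have h1 := abs_sin_pow_le_one (π * u) 4
  have h2 := abs_cos_le_one (π * u / N)
  have h3 := sq_inv_le_cosecScaled_sq h
  have h4 : |2 * cosecScaled N u ^ 2 * (N : ℝ)⁻¹ ^ 2 - 3 * cosecScaled N u ^ 4| ≤
      3 * |cosecScaled N u| ^ 4 := by
    rw [(by ring : |cosecScaled N u| ^ 4 = (|cosecScaled N u| ^ 2) ^ 2), sq_abs]
    have h5 := mul_le_mul_of_nonneg_left h3 (sq_nonneg (cosecScaled N u))
    have h6 : 0 ≤ cosecScaled N u ^ 2 * (N : ℝ)⁻¹ ^ 2 := by positivity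
    rw [abs_le]
    constructor <;> nlinarith
  rw [jackOddDeriv]
  calc _ ≤ 4 * |sin (π * u) ^ 3 * cos (π * u)| * |cosecScaled N u| ^ 3 * |cos (π * u / N)| +
        |sin (π * u)| ^ 4 *
          |2 * cosecScaled N u ^ 2 * (N : ℝ)⁻¹ ^ 2 - 3 * cosecScaled N u ^ 4| := by
        refine (abs_add_le _ _).trans_eq ?_
        simp only [abs_mul, abs_pow, Nat.abs_ofNat]
    _ ≤ 4 * 0.325 * |cosecScaled N u| ^ 3 * 1 + 1 * (3 * |cosecScaled N u| ^ 4) := by gcongr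
    _ = _ := by ring

lemma abs_jackDeriv₂_le (h : sin (π * u / N) ≠ 0) (hw : |cosecScaled N u| ≤ 0.43) :
    |jackDeriv₂ N u| ≤ 4 * π ^ 2 * |cosecScaled N u| ^ 4 * (1 + 2.6 * |cosecScaled N u|) := by
  have h0 := abs_sin_cube_mul_cos_le (π * u)
  have h2 := abs_cos_le_one (π * u / N)
  have h3 := sq_inv_le_cosecScaled_sq h
  have h4 : cosecScaled N u ^ 2 ≤ 0.43 ^ 2 := by rw [← sq_abs]; gcongr
  -- E ≤ 1 because N⁻² ≤ w², and E ≥ 0 because 5 · 0.43² < 1; this is where the cutoff 0.43 is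
  -- needed.
  have h5 := abs_trig_quadratic_le (π * u)
    (E := 1 + 4 * (N : ℝ)⁻¹ ^ 2 - 5 * cosecScaled N u ^ 2) (by nlinarith) (by nlinarith)
  rw [jackDeriv₂, abs_mul, abs_mul, abs_of_pos (by positivity : 0 < 4 * π ^ 2), abs_pow]
  gcongr
  refine (abs_sub _ _).trans ?_
  calc _ ≤ 1 + 8 * |cos (π * u / N)| * |cosecScaled N u| * |sin (π * u) ^ 3 * cos (π * u)| := by
        refine add_le_add h5 (le_of_eq ?_)
        simp only [abs_mul, abs_pow, Nat.abs_ofNat]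
    _ ≤ 1 + 8 * 1 * |cosecScaled N u| * 0.325 := by gcongr
    _ = _ := by ring

lemma abs_jackOddDeriv₂_le (h : sin (π * u / N) ≠ 0) (hw : |cosecScaled N u| ≤ 0.43) :
    |jackOddDeriv₂ N u| ≤ 4 * π * |cosecScaled N u| ^ 3 * (1 + 1.95 * |cosecScaled N u|) := by
  have h0 := abs_sin_cube_mul_cos_le (π * u)
  have h2 := abs_cos_le_one (π * u / N)
  have h3 := sq_inv_le_cosecScaled_sq h
  have h4 : cosecScaled N u ^ 2 ≤ 0.43 ^ 2 := by rw [← sq_abs]; gcongr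
  have h5 := abs_trig_quadratic_le (π * u)
    (E := 1 + (N : ℝ)⁻¹ ^ 2 - 3 * cosecScaled N u ^ 2) (by nlinarith) (by nlinarith)
  have h6 : |4 * cosecScaled N u ^ 2 * (N : ℝ)⁻¹ ^ 2 - 6 * cosecScaled N u ^ 4| ≤
      6 * |cosecScaled N u| ^ 4 := by
    rw [(by ring : |cosecScaled N u| ^ 4 = (|cosecScaled N u| ^ 2) ^ 2), sq_abs]
    have h5 := mul_le_mul_of_nonneg_left h3 (sq_nonneg (cosecScaled N u))
    have h6 : 0 ≤ cosecScaled N u ^ 2 * (N : ℝ)⁻¹ ^ 2 := by positivity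
    rw [abs_le]
    constructor <;> nlinarith
  rw [jackOddDeriv₂, abs_mul, abs_of_pos (by positivity : 0 < 4 * π), mul_assoc (4 * π)]
  refine mul_le_mul_of_nonneg_left ?_ (by positivity)
  refine (abs_add_le _ _).trans ?_
  rw [abs_mul, abs_mul, abs_pow, abs_mul (_ * _)]
  calc _ ≤ |cosecScaled N u| ^ 3 * 1 * 1 + 0.325 * (6 * |cosecScaled N u| ^ 4) := by gcongr
    _ = _ := by ring

end Kernel

/-! ### Trigonometric polynomials -/

/-- The space of trigonometric polynomials of degree at most `M`. -/
noncomputable def trigPoly (M : ℕ) : Submodule ℂ (Torus → ℂ) :=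
  Submodule.span ℂ ((fun m : ℤ => (fourier m : Torus → ℂ)) '' Finset.Icc (-(M : ℤ)) (M : ℤ))

lemma exists_trigSum_of_mem {M : ℕ} {f : Torus → ℂ} (hf : f ∈ trigPoly M) :
    ∃ c : ℤ → ℂ, f = trigSum M c := by
  obtain ⟨c, hc⟩ := (Submodule.mem_span_image_finset_iff_exists_fun ℂ).1 hf
  refine ⟨fun m => if h : m ∈ Finset.Icc (-(M : ℤ)) (M : ℤ) then c ⟨m, h⟩ else 0, ?_⟩
  rw [← hc]
  ext x
  rw [trigSum]
  refine Eq.trans ?_ (Finset.sum_coe_sort _ _)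
  simp only [Finset.sum_apply, Pi.smul_apply, smul_eq_mul, Finset.coe_mem, dite_true]

lemma fourier_mem_trigPoly {M : ℕ} {m : ℤ} (h1 : -(M : ℤ) ≤ m) (h2 : m ≤ M) :
    (fourier m : Torus → ℂ) ∈ trigPoly M :=
  Submodule.subset_span ⟨m, by simp [h1, h2], rfl⟩

lemma mul_mem_trigPoly {M L : ℕ} {f g : Torus → ℂ} (hf : f ∈ trigPoly M) (hg : g ∈ trigPoly L) :
    f * g ∈ trigPoly (M + L) := by
  have h := Submodule.mul_mem_mul hf hg
  rw [trigPoly, trigPoly, Submodule.span_mul_span] at h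
  refine Submodule.span_mono ?_ h
  rintro _ ⟨_, ⟨m, hm, rfl⟩, _, ⟨n, hn, rfl⟩, rfl⟩
  refine ⟨m + n, ?_, ?_⟩
  · simp only [Finset.coe_Icc, Set.mem_Icc] at hm hn ⊢
    push_cast; omega
  · ext x; simp

lemma trigPoly_mono {M L : ℕ} (h : M ≤ L) : trigPoly M ≤ trigPoly L := by
  refine Submodule.span_mono (Set.image_mono ?_)
  rw [Finset.coe_subset]
  exact Finset.Icc_subset_Icc (by omega) (by omega)

lemma comp_sub_mem_trigPoly {M : ℕ} {f : Torus → ℂ} (hf : f ∈ trigPoly M) (s : Torus) :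
    (fun x => f (x - s)) ∈ trigPoly M := by
  induction hf using Submodule.span_induction with
  | mem f h =>
    obtain ⟨m, hm, rfl⟩ := h
    have : (fun x : Torus => (fourier m (x - s) : ℂ)) =
        (fourier m (-s) : ℂ) • (fourier m : Torus → ℂ) := by
      ext x
      simp only [Pi.smul_apply, smul_eq_mul, fourier_apply, ← Circle.coe_mul,
        ← AddCircle.toCircle_add, ← smul_add]
      rw [sub_eq_neg_add]
    simp only [this]
    exact Submodule.smul_mem _ _ (Submodule.subset_span ⟨m, hm, rfl⟩)
  | zero => exact Submodule.zero_mem _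
  | add f g _ _ hf hg => exact Submodule.add_mem _ hf hg
  | smul c f _ hf => exact Submodule.smul_mem _ c hf

/-! ### The Jackson kernel on the circle -/

/-- The Jackson kernel as a function on the circle. -/
noncomputable def jackT (N : ℕ) : Torus → ℂ :=
  ((N : ℂ)⁻¹ ^ 4) • ((∑ k ∈ Finset.range N, (fourier (k : ℤ) : Torus → ℂ)) *
    (∑ k ∈ Finset.range N, (fourier (k : ℤ) : Torus → ℂ)) *
    ((∑ k ∈ Finset.range N, (fourier (-(k : ℤ)) : Torus → ℂ)) *
    (∑ k ∈ Finset.range N, (fourier (-(k : ℤ)) : Torus → ℂ))))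

/-- The odd companion of the Jackson kernel as a function on the circle. -/
noncomputable def jackOddT (N : ℕ) : Torus → ℂ :=
  jackT N * ((N : ℂ) / (4 * Real.pi * Complex.I)) •
    ((fourier 1 : Torus → ℂ) - (fourier (-1) : Torus → ℂ))

/-- Both sides equal |e^{2iy} - 1|². -/
lemma sin_sq_of_exp (y : ℝ) : (Complex.exp (2 * y * Complex.I) - 1) *
    ((Complex.exp (2 * y * Complex.I))⁻¹ - 1) = 4 * (Real.sin y : ℂ) ^ 2 := by
  have h := Complex.exp_ne_zero (y * Complex.I)
  rw [Complex.ofReal_sin, Complex.sin, mul_assoc, two_mul, Complex.exp_add, neg_mul,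
    Complex.exp_neg]
  have hI : Complex.I ^ 2 = -1 := Complex.I_sq
  field_simp
  rw [hI]
  ring

lemma jackT_mem {N : ℕ} (hN : 0 < N) : jackT N ∈ trigPoly (2 * N - 2) := by
  have h1 : (∑ k ∈ Finset.range N, (fourier (k : ℤ) : Torus → ℂ)) *
      (∑ k ∈ Finset.range N, (fourier (-(k : ℤ)) : Torus → ℂ)) ∈ trigPoly (N - 1) := by
    rw [Finset.sum_mul_sum]
    refine Submodule.sum_mem _ fun k hk => Submodule.sum_mem _ fun l hl => ?_
    have : (fourier (k : ℤ) : Torus → ℂ) * (fourier (-(l : ℤ)) : Torus → ℂ) =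
        (fourier ((k : ℤ) + -(l : ℤ)) : Torus → ℂ) := by ext x; rw [fourier_add]; rfl
    rw [this]
    rw [Finset.mem_range] at hk hl
    exact fourier_mem_trigPoly (by omega) (by omega)
  have h2 := Submodule.smul_mem _ ((N : ℂ)⁻¹ ^ 4) (mul_mem_trigPoly h1 h1)
  -- Regrouping exhibits the kernel as the square of a Fejér kernel of degree N - 1.
  rw [mul_mul_mul_comm, ← jackT] at h2
  convert h2 using 2
  omega

lemma jackOddT_mem {N : ℕ} (hN : 0 < N) : jackOddT N ∈ trigPoly (2 * N - 1) := by
  have h1 : ((N : ℂ) / (4 * Real.pi * Complex.I)) •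
      ((fourier 1 : Torus → ℂ) - (fourier (-1) : Torus → ℂ)) ∈ trigPoly 1 :=
    Submodule.smul_mem _ _ (Submodule.sub_mem _ (fourier_mem_trigPoly (by simp) (by simp))
      (fourier_mem_trigPoly (by simp) (by simp)))
  have h2 := mul_mem_trigPoly (jackT_mem hN) h1
  rw [← jackOddT] at h2
  convert h2 using 2
  omega

lemma jackT_zero {N : ℕ} (hN : 0 < N) : jackT N 0 = 1 := by
  have : (N : ℂ) ≠ 0 := by exact_mod_cast hN.ne'
  simp only [jackT, Pi.smul_apply, Pi.mul_apply, Finset.sum_apply, fourier_eval_zero,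
    Finset.sum_const, Finset.card_range, smul_eq_mul, nsmul_eq_mul, mul_one]
  field_simp

lemma jackOddT_zero (N : ℕ) : jackOddT N 0 = 0 := by
  simp [jackOddT]

lemma fourier_scaled (N : ℕ) (m : ℤ) (u : ℝ) : (fourier m ((u / N : ℝ) : Torus) : ℂ) =
    Complex.exp (2 * (Real.pi * u / N : ℝ) * Complex.I) ^ m := by
  rw [fourier_coe_apply, ← Complex.exp_int_mul]
  congr 1
  push_cast
  ring

lemma jackT_coe {N : ℕ} {u : ℝ} (h : Real.sin (Real.pi * u / N) ≠ 0) :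
    jackT N ((u / N : ℝ) : Torus) = jack N u := by
  have hN : (N : ℝ) ≠ 0 := by rintro h0; simp [h0] at h
  have hN' : (N : ℂ) ≠ 0 := by exact_mod_cast hN
  have hs' : (Real.sin (Real.pi * u / N) : ℂ) ≠ 0 := by exact_mod_cast h
  set z := Complex.exp (2 * (Real.pi * u / N : ℝ) * Complex.I) with hz
  have e1 := sin_sq_of_exp (Real.pi * u / N)
  rw [← hz] at e1
  have e2 := sin_sq_of_exp (Real.pi * u)
  have hzN : Complex.exp (2 * (Real.pi * u : ℝ) * Complex.I) = z ^ N := by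
    rw [hz, ← Complex.exp_nat_mul]
    congr 1
    push_cast
    field_simp
  rw [hzN] at e2
  have g1 := geom_sum_mul z N
  have g2 := geom_sum_mul z⁻¹ N
  rw [inv_pow] at g2
  -- Geometric sums give the closed form of the Fejér kernel; squaring it gives the Jackson kernel.
  have key : (∑ k ∈ Finset.range N, z ^ k) * (∑ k ∈ Finset.range N, z⁻¹ ^ k) *
      (Real.sin (Real.pi * u / N) : ℂ) ^ 2 = (Real.sin (Real.pi * u) : ℂ) ^ 2 := by
    have : (4 : ℂ) ≠ 0 := by norm_num
    apply mul_left_cancel₀ this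
    rw [← e2, ← g1, ← g2]
    linear_combination (-(∑ k ∈ Finset.range N, z ^ k) * (∑ k ∈ Finset.range N, z⁻¹ ^ k)) * e1
  have hsum1 : ∀ k : ℕ, (fourier (k : ℤ) ((u / N : ℝ) : Torus) : ℂ) = z ^ k := fun k => by
    rw [fourier_scaled, zpow_natCast]
  have hsum2 : ∀ k : ℕ, (fourier (-(k : ℤ)) ((u / N : ℝ) : Torus) : ℂ) = z⁻¹ ^ k := fun k => by
    rw [fourier_scaled, zpow_neg, zpow_natCast, inv_pow]
  simp only [jackT, Pi.smul_apply, Pi.mul_apply, Finset.sum_apply, smul_eq_mul]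
  simp only [hsum1, hsum2, jack, cosecScaled]
  push_cast [← Complex.ofReal_sin] at key ⊢
  rw [mul_inv, mul_pow]
  rw [← eq_div_iff (pow_ne_zero 2 (by exact_mod_cast h))] at key
  rw [mul_mul_mul_comm, key]
  field_simp

lemma jackOddT_coe {N : ℕ} {u : ℝ} (h : Real.sin (Real.pi * u / N) ≠ 0) :
    jackOddT N ((u / N : ℝ) : Torus) = jackOdd N u := by
  have hN : (N : ℝ) ≠ 0 := by rintro h0; simp [h0] at h
  have hN' : (N : ℂ) ≠ 0 := by exact_mod_cast hN
  have hπ : (Real.pi : ℂ) ≠ 0 := by exact_mod_cast Real.pi_ne_zero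
  rw [jackOdd_eq_mul h]
  push_cast
  rw [← jackT_coe h, jackOddT]
  simp only [Pi.mul_apply, Pi.smul_apply, Pi.sub_apply, smul_eq_mul]
  congr 1
  rw [fourier_scaled, fourier_scaled, zpow_one, zpow_neg, zpow_one, ← Complex.exp_neg]
  have h2 := Complex.sin_two_mul ((Real.pi * u / N : ℝ) : ℂ)
  rw [Complex.sin] at h2
  push_cast at h2 ⊢
  have hI : Complex.I ≠ 0 := Complex.I_ne_zero
  have hI2 : Complex.I ^ 2 = -1 := Complex.I_sq
  simp only [neg_mul] at h2 ⊢
  generalize Complex.exp (2 * (Real.pi * u / N) * Complex.I) = a at *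
  generalize Complex.exp (-(2 * (Real.pi * u / N) * Complex.I)) = b at *
  field_simp
  linear_combination (2 * Complex.I) * h2 + (a - b) * hI2

/-! ### Sums over separated points of the circle -/

lemma exists_lift (x : Torus) : ∃ t : ℝ, (t : Torus) = x ∧ |t| = ‖x‖ := by
  obtain ⟨y, rfl⟩ := QuotientAddGroup.mk_surjective x
  refine ⟨y - round y, ?_, (UnitAddCircle.norm_eq).symm⟩
  have h : ((round y : ℝ) : Torus) = 0 :=
    (AddCircle.coe_eq_zero_iff (p := (1 : ℝ))).2 ⟨round y, by simp⟩
  rw [AddCircle.coe_sub, h, sub_zero]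

lemma norm_le_half (x : Torus) : ‖x‖ ≤ 1 / 2 := by
  have := AddCircle.norm_le_half_period (p := (1 : ℝ)) one_ne_zero (x := x)
  simpa using this

lemma norm_coe_le (t : ℝ) : ‖(t : Torus)‖ ≤ |t| :=
  QuotientAddGroup.norm_mk_le_norm

lemma floor_ne_of_add_one_le {a b : ℝ} (ha : 0 ≤ a) (hab : a + 1 ≤ b) : ⌊a⌋₊ ≠ ⌊b⌋₊ := by
  have h1 := Nat.lt_floor_add_one b
  have h2 := Nat.floor_le ha
  intro h
  rw [← h] at h1
  linarith

lemma sum_comp_le_sum_range {ι : Type*} (T : Finset ι) (k : ι → ℕ)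
    (hk : Set.InjOn k T) {n : ℕ} (hn : ∀ i ∈ T, k i < n) {φ : ℕ → ℝ} (hφ : ∀ k, 0 ≤ φ k) :
    ∑ i ∈ T, φ (k i) ≤ ∑ j ∈ Finset.range n, φ j := by
  classical
  rw [← Finset.sum_image (f := φ) hk]
  refine Finset.sum_le_sum_of_subset_of_nonneg ?_ fun _ _ _ => hφ _
  intro j hj
  obtain ⟨i, hi, rfl⟩ := Finset.mem_image.1 hj
  exact Finset.mem_range.2 (hn i hi)

/-- Points of the circle at mutual distances at least `1 / N` are distributed around any point `y`
at most two per distance bin of width `1 / N`. -/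
lemma sum_le_of_separated {N : ℕ} (S : Finset Torus)
    (hsep : ∀ s ∈ S, ∀ t ∈ S, s ≠ t → 1 ≤ N * ‖s - t‖) (y : Torus)
    {φ : ℕ → ℝ} (hφ : ∀ k, 0 ≤ φ k) {f : Torus → ℝ} (hf : ∀ s ∈ S, f s ≤ φ ⌊N * ‖s - y‖⌋₊) :
    ∑ s ∈ S, f s ≤ 2 * ∑ k ∈ Finset.range (N / 2 + 1), φ k := by
  classical
  choose l hl1 hl2 using fun s : Torus => exists_lift (s - y)
  have hbound : ∀ s ∈ S, ⌊N * ‖s - y‖⌋₊ < N / 2 + 1 := fun s _ => by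
    rw [Nat.lt_succ_iff]
    refine (Nat.floor_mono (?_ : _ ≤ (N : ℝ) / (2 : ℕ))).trans_eq (Nat.floor_div_eq_div N 2)
    have := norm_le_half (s - y)
    push_cast
    nlinarith [Nat.cast_nonneg (α := ℝ) N]
  have hdist : ∀ s ∈ S, ∀ t ∈ S, s ≠ t → 1 ≤ N * |l s - l t| := fun s hs t ht hst => by
    refine (hsep s hs t ht hst).trans ?_
    gcongr
    have : s - t = ((l s - l t : ℝ) : Torus) := by
      rw [AddCircle.coe_sub, hl1, hl1]; abel
    rw [this]
    exact norm_coe_le _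
  have hN0 : (0 : ℝ) ≤ N := Nat.cast_nonneg N
  -- On one side of y the distance between lifts is the difference of their moduli, so two nodes
  -- sharing a bin would be closer than 1/N. The two sides of y account for the factor 2.
  have hinj : ∀ s ∈ S, ∀ t ∈ S, 0 ≤ l s * l t →
      ⌊(N : ℝ) * ‖s - y‖⌋₊ = ⌊(N : ℝ) * ‖t - y‖⌋₊ → s = t := by
    intro s hs t ht hsign heq
    by_contra hst
    have h1 := hdist s hs t ht hst
    have habs : |l s - l t| = |(|l s| - |l t|)| := by
      have : (l s - l t) ^ 2 = (|l s| - |l t|) ^ 2 := by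
        have h2 : |l s| * |l t| = l s * l t := by rw [← abs_mul, abs_of_nonneg hsign]
        nlinarith [sq_abs (l s), sq_abs (l t)]
      exact sq_eq_sq_iff_abs_eq_abs _ _ |>.1 this
    rw [habs, hl2, hl2] at h1
    rcases le_total (‖t - y‖) (‖s - y‖) with h | h
    · rw [abs_of_nonneg (sub_nonneg.2 h)] at h1
      exact floor_ne_of_add_one_le (by positivity) (by linarith) heq.symm
    · rw [abs_of_nonpos (sub_nonpos.2 h)] at h1
      exact floor_ne_of_add_one_le (by positivity) (by linarith) heq
  refine (Finset.sum_le_sum hf).trans ?_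
  rw [← Finset.sum_filter_add_sum_filter_not S (fun s => 0 ≤ l s), two_mul]
  refine add_le_add (sum_comp_le_sum_range _ _ ?_ ?_ hφ) (sum_comp_le_sum_range _ _ ?_ ?_ hφ)
  · intro s hs t ht h
    simp only [Finset.coe_filter, Set.mem_ofPred_eq] at hs ht
    exact hinj s hs.1 t ht.1 (mul_nonneg hs.2 ht.2) h
  · exact fun s hs => hbound s (Finset.mem_filter.1 hs).1
  · intro s hs t ht h
    simp only [Finset.coe_filter, Set.mem_ofPred_eq, not_le] at hs ht
    exact hinj s hs.1 t ht.1 (mul_nonneg_of_nonpos_of_nonpos hs.2.le ht.2.le) h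
  · exact fun s hs => hbound s (Finset.mem_filter.1 hs).1

/-! ### Elementary bounds for sine -/

section Trig

open Real

/-- This and the next two bounds come from integrating 1 - x²/2 ≤ cos x repeatedly from 0. -/
lemma sub_cube_div_six_le_sin {x : ℝ} (hx : 0 ≤ x) : x - x ^ 3 / 6 ≤ sin x := by
  have hd : ∀ y : ℝ, HasDerivAt (fun y => sin y - (y - y ^ 3 / 6)) (cos y - (1 - y ^ 2 / 2)) y := by
    intro y
    refine ((hasDerivAt_sin y).sub ((hasDerivAt_id y).sub
      ((hasDerivAt_pow 3 y).div_const 6))).congr_deriv ?_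
    push_cast; ring
  have hm : MonotoneOn (fun y => sin y - (y - y ^ 3 / 6)) (Set.Ici 0) := by
    refine monotoneOn_of_deriv_nonneg (convex_Ici 0)
      (fun y _ => (hd y).continuousAt.continuousWithinAt)
      (fun y _ => (hd y).differentiableAt.differentiableWithinAt) fun y _ => ?_
    rw [(hd y).deriv]
    linarith [one_sub_sq_div_two_le_cos (x := y)]
  have := hm (Set.mem_Ici.2 le_rfl) (Set.mem_Ici.2 hx) hx
  simp at this
  linarith

lemma cos_le_quartic {x : ℝ} (hx : 0 ≤ x) : cos x ≤ 1 - x ^ 2 / 2 + x ^ 4 / 24 := by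
  have hd : ∀ y : ℝ, HasDerivAt (fun y => (1 - y ^ 2 / 2 + y ^ 4 / 24) - cos y)
      (sin y - (y - y ^ 3 / 6)) y := by
    intro y
    refine ((((hasDerivAt_const y (1 : ℝ)).sub ((hasDerivAt_pow 2 y).div_const 2)).add
      ((hasDerivAt_pow 4 y).div_const 24)).sub (hasDerivAt_cos y)).congr_deriv ?_
    push_cast; ring
  have hm : MonotoneOn (fun y => (1 - y ^ 2 / 2 + y ^ 4 / 24) - cos y) (Set.Ici 0) := by
    refine monotoneOn_of_deriv_nonneg (convex_Ici 0)
      (fun y _ => (hd y).continuousAt.continuousWithinAt)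
      (fun y _ => (hd y).differentiableAt.differentiableWithinAt) fun y hy => ?_
    rw [interior_Ici, Set.mem_Ioi] at hy
    rw [(hd y).deriv]
    linarith [sub_cube_div_six_le_sin hy.le]
  have := hm (Set.mem_Ici.2 le_rfl) (Set.mem_Ici.2 hx) hx
  simp at this
  linarith

lemma sin_le_quintic {x : ℝ} (hx : 0 ≤ x) : sin x ≤ x - x ^ 3 / 6 + x ^ 5 / 120 := by
  have hd : ∀ y : ℝ, HasDerivAt (fun y => (y - y ^ 3 / 6 + y ^ 5 / 120) - sin y)
      ((1 - y ^ 2 / 2 + y ^ 4 / 24) - cos y) y := by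
    intro y
    refine ((((hasDerivAt_id y).sub ((hasDerivAt_pow 3 y).div_const 6)).add
      ((hasDerivAt_pow 5 y).div_const 120)).sub (hasDerivAt_sin y)).congr_deriv ?_
    push_cast; ring
  have hm : MonotoneOn (fun y => (y - y ^ 3 / 6 + y ^ 5 / 120) - sin y) (Set.Ici 0) := by
    refine monotoneOn_of_deriv_nonneg (convex_Ici 0)
      (fun y _ => (hd y).continuousAt.continuousWithinAt)
      (fun y _ => (hd y).differentiableAt.differentiableWithinAt) fun y hy => ?_
    rw [interior_Ici, Set.mem_Ioi] at hy
    rw [(hd y).deriv]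
    linarith [cos_le_quartic hy.le]
  have := hm (Set.mem_Ici.2 le_rfl) (Set.mem_Ici.2 hx) hx
  simp at this
  linarith

end Trig

/-! ### Numerical bounds for the decay of the kernel -/

section Decay

open Real

variable {N : ℕ}

lemma abs_sin_pi_mul_eq (t : ℝ) : |sin (π * t)| = sin (π * ‖(t : Torus)‖) := by
  rw [UnitAddCircle.norm_eq]
  have h1 : |sin (π * t)| = |sin (π * (t - round t))| := by
    have : π * (t - round t) = π * t - round t * π := by ring
    rw [this, sin_sub_int_mul_pi, abs_mul, abs_zpow, abs_neg, abs_one, one_zpow, one_mul]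
  have h2 : |t - round t| ≤ 1 := (abs_sub_round t).trans (by norm_num)
  rw [h1, ← abs_of_pos pi_pos, ← abs_mul, abs_of_pos pi_pos]
  have h3 : |π * (t - round t)| ≤ π := by
    rw [abs_mul, abs_of_pos pi_pos]
    exact mul_le_of_le_one_right pi_pos.le h2
  rw [abs_sin_eq_sin_abs_of_abs_le_pi h3]

/-- The kernel weight at a point is controlled by its torus distance to the origin. -/
lemma abs_cosecScaled_le (hN : 0 < N) {u r : ℝ} (hr : 0 < r)
    (h : r ≤ N * ‖((u / N : ℝ) : Torus)‖) :
    |cosecScaled N u| ≤ cosecScaled N r ∧ sin (π * u / N) ≠ 0 ∧ 0 < sin (π * r / N) := by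
  have hN' : (0 : ℝ) < N := by exact_mod_cast hN
  have h1 : |sin (π * u / N)| = sin (π * ‖((u / N : ℝ) : Torus)‖) := by
    rw [← abs_sin_pi_mul_eq, mul_div_assoc]
  have h2 := norm_le_half ((u / N : ℝ) : Torus)
  have h3 : r / N ≤ ‖((u / N : ℝ) : Torus)‖ := by rw [div_le_iff₀ hN']; linarith
  have h4 : 0 < r / N := by positivity
  have h5 : 0 < sin (π * r / N) := by
    rw [mul_div_assoc]
    exact sin_pos_of_pos_of_lt_pi (by positivity) (by nlinarith [pi_pos])
  have h6 : sin (π * r / N) ≤ |sin (π * u / N)| := by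
    rw [h1, mul_div_assoc]
    refine sin_le_sin_of_le_of_le_pi_div_two ?_ ?_ ?_
    · nlinarith [pi_pos, mul_pos pi_pos h4]
    · nlinarith [pi_pos]
    · gcongr
  refine ⟨?_, abs_pos.1 (h5.trans_le h6), h5⟩
  rw [cosecScaled, cosecScaled, abs_inv, abs_mul, abs_of_pos hN']
  gcongr

/-- Jordan's inequality: crude, but valid up to the antipode r = N/2. -/
lemma cosecScaled_le_two (hN : 0 < N) {r : ℝ} (hr : 0 < r) (h : r ≤ N / 2) :
    cosecScaled N r ≤ (2 * r)⁻¹ := by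
  have hN' : (0 : ℝ) < N := by exact_mod_cast hN
  rw [cosecScaled]
  refine inv_anti₀ (by positivity) ?_
  have h1 : 2 / π * (π * r / N) ≤ sin (π * r / N) := by
    refine mul_le_sin (by positivity) ?_
    rw [div_le_div_iff₀ hN' (by norm_num)]
    nlinarith [pi_pos]
  calc 2 * r = N * (2 / π * (π * r / N)) := by field_simp
    _ ≤ _ := by gcongr

/-- From sin y ≥ y - y³/6 ≥ δ y; for r small against N, δ is close to 1 and the bound close to the
ideal 1/(πr). -/
lemma cosecScaled_le_of_le (hN : 0 < N) {r δ : ℝ} (hr : 0 < r) (hδ : 0 < δ)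
    (h : (π * r / N) ^ 2 ≤ 6 * (1 - δ)) :
    cosecScaled N r ≤ (δ * π * r)⁻¹ := by
  have hN' : (0 : ℝ) < N := by exact_mod_cast hN
  rw [cosecScaled]
  refine inv_anti₀ (by positivity) ?_
  have hy : 0 < π * r / N := by positivity
  have h1 := sub_cube_div_six_le_sin hy.le
  have h2 : δ * (π * r / N) ≤ sin (π * r / N) := by nlinarith
  calc δ * π * r = N * (δ * (π * r / N)) := by field_simp
    _ ≤ _ := by gcongr

/-- An explicit majorant of the cubes of the kernel weights in the bins of width `1 / N`. -/
noncomputable def binWeight (c : ℝ) (k : ℕ) : ℝ :=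
  if k = 0 then 0 else if k ≤ 6 then (3.0958 * (k - c))⁻¹ ^ 3 else (2 * (k - c))⁻¹ ^ 3

lemma binWeight_nonneg {c : ℝ} (hc : c ≤ 1) (k : ℕ) : 0 ≤ binWeight c k := by
  unfold binWeight
  split_ifs with h1 h2
  · exact le_rfl
  all_goals
    have : (1 : ℝ) ≤ k := by exact_mod_cast Nat.one_le_iff_ne_zero.2 h1
    have : 0 ≤ (k : ℝ) - c := by linarith
    positivity

/-- By convexity x⁻³ is at most the integral of t⁻³ over [x - 1/2, x + 1/2], and these integrals
telescope. -/
lemma sum_inv_cube_le {a : ℝ} (ha : 1 / 2 < a) (n : ℕ) :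
    ∑ k ∈ Finset.range n, ((k + a)⁻¹ : ℝ) ^ 3 ≤
      1 / (2 * (a - 1 / 2) ^ 2) - 1 / (2 * (n + a - 1 / 2) ^ 2) := by
  induction n with
  | zero => simp
  | succ n ih =>
    rw [Finset.sum_range_succ]
    have hn : (0 : ℝ) ≤ n := Nat.cast_nonneg n
    have key : ((n + a)⁻¹ : ℝ) ^ 3 ≤
        1 / (2 * (n + a - 1 / 2) ^ 2) - 1 / (2 * ((n + 1 : ℕ) + a - 1 / 2) ^ 2) := by
      push_cast
      have hx : 1 / 2 < n + a := by linarith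
      have e1 : (n : ℝ) + 1 + a - 1 / 2 = (n + a) + 1 / 2 := by ring
      rw [e1]
      generalize (n : ℝ) + a = x at *
      have h1 : 0 < x - 1 / 2 := by linarith
      have h2 : 0 < x + 1 / 2 := by linarith
      have h3 : 0 < x := by linarith
      have h4 : 1 / (2 * (x - 1 / 2) ^ 2) - 1 / (2 * (x + 1 / 2) ^ 2) =
          x / ((x - 1 / 2) ^ 2 * (x + 1 / 2) ^ 2) := by
        rw [div_sub_div _ _ (by positivity) (by positivity),
          div_eq_div_iff (by positivity) (by positivity)]
        ring
      rw [h4, inv_pow, inv_eq_one_div, div_le_div_iff₀ (by positivity) (by positivity)]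
      nlinarith [sq_nonneg x]
    linarith

lemma sum_binWeight_le {c : ℝ} (hc : c ≤ 1 / 2) (n : ℕ) :
    ∑ k ∈ Finset.range (n + 7), binWeight c k ≤
      ∑ k ∈ Finset.range 7, binWeight c k + 1 / (16 * (13 / 2 - c) ^ 2) := by
  rw [add_comm n, Finset.sum_range_add]
  gcongr
  have h := sum_inv_cube_le (a := 7 - c) (by linarith) n
  have h2 : ∀ k ∈ Finset.range n, binWeight c (7 + k) = 1 / 8 * ((k + (7 - c))⁻¹ : ℝ) ^ 3 := by
    intro k _
    rw [binWeight, if_neg (by omega), if_neg (by omega), mul_inv, mul_pow]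
    push_cast
    rw [show (7 : ℝ) + k - c = k + (7 - c) by ring]
    norm_num
  rw [Finset.sum_congr rfl h2, ← Finset.mul_sum]
  have h3 : 0 ≤ 1 / (2 * (n + (7 - c) - 1 / 2) ^ 2) := by positivity
  have h4 : 1 / (16 * (13 / 2 - c) ^ 2) = 1 / 8 * (1 / (2 * ((7 - c) - 1 / 2) ^ 2)) := by
    have : 13 / 2 - c ≠ 0 := by linarith
    have : 7 - c - 1 / 2 = 13 / 2 - c := by ring
    rw [this]
    field_simp
    norm_num
  rw [h4]
  linarith

lemma cosecScaled_pow_le_binWeight (hN : 64 ≤ N) {c : ℝ} (hc0 : 0 ≤ c) (hc : c ≤ 1 / 2) {k : ℕ}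
    (hk : 1 ≤ k) (hk2 : (k : ℝ) ≤ N / 2) (hpos : 0 < sin (π * (k - c) / N)) :
    cosecScaled N (k - c) ^ 3 ≤ binWeight c k := by
  have hk' : (1 : ℝ) ≤ k := by exact_mod_cast hk
  have hr : 0 < (k : ℝ) - c := by linarith
  have hN' : (64 : ℝ) ≤ N := by exact_mod_cast hN
  have h0 : 0 ≤ cosecScaled N (k - c) := by
    rw [cosecScaled]; positivity
  rw [binWeight, if_neg (by omega)]
  split_ifs with h6
  · have h6' : (k : ℝ) ≤ 6 := by exact_mod_cast h6
    gcongr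
    -- Here r ≤ 6 and N ≥ 64, so πr/N ≤ 6π/64 < 0.2946; and 0.98547 π > 3.0958.
    refine (cosecScaled_le_of_le (by omega) hr (δ := 0.98547) (by norm_num) ?_).trans ?_
    · have : π * (k - c) / N ≤ 0.2946 := by
        rw [div_le_iff₀ (by linarith)]
        nlinarith [pi_lt_d4, pi_pos]
      calc (π * (k - c) / N) ^ 2 ≤ 0.2946 ^ 2 := by
            gcongr
        _ ≤ _ := by norm_num
    · gcongr
      nlinarith [pi_gt_d4]
  · gcongr
    exact cosecScaled_le_two (by omega) hr (by linarith)

/-- The cubes of the kernel weights over separated points outside the first bin. -/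
lemma sum_cosecScaled_pow_le (hN : 64 ≤ N) {c : ℝ} (hc0 : 0 ≤ c) (hc : c ≤ 1 / 2)
    (S : Finset Torus) (hsep : ∀ s ∈ S, ∀ t ∈ S, s ≠ t → 1 ≤ N * ‖s - t‖) (y : Torus)
    (U : Torus → ℝ) (hU : ∀ s ∈ S, 1 ≤ N * ‖s - y‖ ∧
      N * ‖s - y‖ - c ≤ N * ‖((U s / N : ℝ) : Torus)‖) :
    ∑ s ∈ S, |cosecScaled N (U s)| ^ 3 ≤
      2 * (∑ k ∈ Finset.range 7, binWeight c k + 1 / (16 * (13 / 2 - c) ^ 2)) := by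
  refine (sum_le_of_separated S hsep y (φ := binWeight c)
    (binWeight_nonneg (by linarith)) fun s hs => ?_).trans ?_
  · obtain ⟨h1, h2⟩ := hU s hs
    have hk : 1 ≤ ⌊(N : ℝ) * ‖s - y‖⌋₊ := Nat.one_le_floor_iff _ |>.2 h1
    have hk1 : (1 : ℝ) ≤ ⌊(N : ℝ) * ‖s - y‖⌋₊ := by exact_mod_cast hk
    have hfl := Nat.floor_le (by positivity : 0 ≤ (N : ℝ) * ‖s - y‖)
    have hb := abs_cosecScaled_le (N := N) (by omega) (u := U s)
      (r := ⌊(N : ℝ) * ‖s - y‖⌋₊ - c) (by linarith) (by linarith)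
    refine (pow_le_pow_left₀ (abs_nonneg _) hb.1 3).trans
      (cosecScaled_pow_le_binWeight hN hc0 hc hk ?_ hb.2.2)
    have := norm_le_half (s - y)
    nlinarith [Nat.cast_nonneg (α := ℝ) N]
  -- The weights are nonnegative, so the range of bins may be enlarged to N + 7.
  · refine mul_le_mul_of_nonneg_left (le_trans ?_ (sum_binWeight_le hc N)) (by norm_num)
    refine Finset.sum_le_sum_of_subset_of_nonneg ?_ fun k _ _ => binWeight_nonneg (by linarith) k
    exact Finset.range_subset_range.2 (by omega)

/-- The shift c = 0 serves sums centred at the evaluation point; c = 1/4 below serves points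
displaced by up to 1/4 from a node. -/
lemma binWeight_sum_zero :
    2 * (∑ k ∈ Finset.range 7, binWeight 0 k + 1 / (16 * (13 / 2 - 0) ^ 2)) ≤ 0.084 := by
  simp only [Finset.sum_range_succ, Finset.sum_range_zero, binWeight]
  norm_num

lemma binWeight_sum_quarter :
    2 * (∑ k ∈ Finset.range 7, binWeight (1 / 4) k + 1 / (16 * (13 / 2 - 1 / 4) ^ 2)) ≤ 0.182 := by
  simp only [Finset.sum_range_succ, Finset.sum_range_zero, binWeight]
  norm_num

lemma cosecScaled_le_of_small (hN : 64 ≤ N) {r : ℝ} (hr : 0 < r) (hr1 : r ≤ 1) :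
    cosecScaled N r ≤ (3.1402 * r)⁻¹ := by
  have hN' : (64 : ℝ) ≤ N := by exact_mod_cast hN
  refine (cosecScaled_le_of_le (by omega) hr (δ := 0.99959) (by norm_num) ?_).trans ?_
  · have : π * r / N ≤ 0.0491 := by
      rw [div_le_iff₀ (by linarith)]
      nlinarith [pi_lt_d4, pi_pos]
    calc (π * r / N) ^ 2 ≤ 0.0491 ^ 2 := by gcongr
      _ ≤ _ := by norm_num
  · gcongr
    nlinarith [pi_gt_d4]

end Decay

/-! ### The kernel near the origin -/

section Central

open Real

variable {N : ℕ} {u : ℝ}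

lemma cosecScaled_neg (N : ℕ) (u : ℝ) : cosecScaled N (-u) = -cosecScaled N u := by
  rw [cosecScaled, cosecScaled, mul_neg, neg_div, sin_neg, mul_neg, inv_neg]

lemma jack_neg (N : ℕ) (u : ℝ) : jack N (-u) = jack N u := by
  rw [jack, jack, cosecScaled_neg, mul_neg, sin_neg]
  ring

lemma jackOdd_neg (N : ℕ) (u : ℝ) : jackOdd N (-u) = -jackOdd N u := by
  rw [jackOdd, jackOdd, cosecScaled_neg, mul_neg, sin_neg, neg_div, cos_neg]
  ring

lemma jack_nonneg (N : ℕ) (u : ℝ) : 0 ≤ jack N u := by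
  rw [jack, ← mul_pow]; positivity

/-- Quintic upper bound for the numerator, cubic lower bound for the denominator; 24576 = 6 · 64².
-/
lemma sin_mul_cosecScaled_le (hN : 64 ≤ N) (hu : 0 < u) (hu1 : u ≤ 1 / 2) :
    0 ≤ sin (π * u) * cosecScaled N u ∧ sin (π * u) * cosecScaled N u ≤
      (1 - (π * u) ^ 2 / 6 + (π * u) ^ 4 / 120) / (1 - (π * u) ^ 2 / 24576) := by
  have hN' : (64 : ℝ) ≤ N := by exact_mod_cast hN
  have hN0 : (0 : ℝ) < N := by linarith
  have hy : 0 < π * u := by positivity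
  have hy2 : π * u ≤ 2 := by nlinarith [pi_le_four]
  have h1 := sin_le_quintic hy.le
  have hθ : 0 < π * u / N := by positivity
  have h2 := sub_cube_div_six_le_sin hθ.le
  have hs0 : 0 ≤ sin (π * u) := sin_nonneg_of_nonneg_of_le_pi hy.le (by linarith [pi_gt_three])
  have h3 : π * u * (1 - (π * u) ^ 2 / 24576) ≤ N * sin (π * u / N) := by
    have h4 : (π * u / N) ^ 2 ≤ (π * u) ^ 2 / 4096 := by
      rw [div_pow]
      gcongr
      nlinarith
    calc π * u * (1 - (π * u) ^ 2 / 24576) ≤ π * u * (1 - (π * u / N) ^ 2 / 6) := by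
          exact mul_le_mul_of_nonneg_left (by linarith) hy.le
      _ = N * (π * u / N - (π * u / N) ^ 3 / 6) := by field_simp
      _ ≤ _ := by gcongr
  have h5 : 0 < 1 - (π * u) ^ 2 / 24576 := by nlinarith
  have h6 : 0 < N * sin (π * u / N) := lt_of_lt_of_le (by positivity) h3
  rw [cosecScaled, ← div_eq_mul_inv]
  refine ⟨by positivity, ?_⟩
  rw [div_le_div_iff₀ h6 h5]
  have h7 : sin (π * u) ≤ π * u * (1 - (π * u) ^ 2 / 6 + (π * u) ^ 4 / 120) := by linarith
  have h8 : 0 ≤ 1 - (π * u) ^ 2 / 6 + (π * u) ^ 4 / 120 := by nlinarith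
  calc _ ≤ π * u * (1 - (π * u) ^ 2 / 6 + (π * u) ^ 4 / 120) * (1 - (π * u) ^ 2 / 24576) := by
        gcongr
    _ = (1 - (π * u) ^ 2 / 6 + (π * u) ^ 4 / 120) * (π * u * (1 - (π * u) ^ 2 / 24576)) := by ring
    _ ≤ _ := by gcongr

lemma pi_mul_sq_bounds (u : ℝ) :
    9.869 * u ^ 2 ≤ (π * u) ^ 2 ∧ (π * u) ^ 2 ≤ 9.87 * u ^ 2 := by
  rw [mul_pow]
  constructor <;> gcongr <;> nlinarith [pi_gt_d4, pi_lt_d4]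

lemma jack_le_near (hN : 64 ≤ N) (hu : |u| ≤ 1 / 4) (hu0 : u ≠ 0) :
    jack N u ≤ 1 - 5.4 * u ^ 2 := by
  wlog hpos : 0 < u generalizing u
  · have := this (u := -u) (by rwa [abs_neg]) (by simpa) (by
      rcases lt_or_gt_of_ne hu0 with h | h <;> linarith)
    rwa [jack_neg, neg_sq] at this
  rw [abs_of_pos hpos] at hu
  obtain ⟨h0, h1⟩ := sin_mul_cosecScaled_le hN hpos (by linarith)
  obtain ⟨hg1, hg2⟩ := pi_mul_sq_bounds u
  have hu2 : u ^ 2 ≤ 1 / 16 := by nlinarith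
  rw [jack, ← mul_pow]
  have e4 : (π * u) ^ 4 = ((π * u) ^ 2) ^ 2 := by ring
  rw [e4] at h1
  have hg0 : 0 ≤ (π * u) ^ 2 := sq_nonneg _
  generalize (π * u) ^ 2 = g at *
  have hg3 : g ≤ 0.6169 := by linarith
  -- The slope 0.161 is just below 1/6, leaving room for the quartic term and the denominator; the
  -- fourth power then has slope 0.5472, and 0.5472 · 9.869 > 5.4.
  have h2 : sin (π * u) * cosecScaled N u ≤ 1 - 0.161 * g := by
    refine h1.trans ?_
    rw [div_le_iff₀ (by linarith)]
    nlinarith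
  calc (sin (π * u) * cosecScaled N u) ^ 4 ≤ (1 - 0.161 * g) ^ 4 := by gcongr
    _ ≤ 1 - 0.5472 * g := by
      have hz : 0 ≤ g ^ 2 := sq_nonneg g
      nlinarith [mul_nonneg hg0 hz, mul_nonneg hz hz, mul_nonneg hg0 (sub_nonneg.2 hg3),
        mul_nonneg hz (sub_nonneg.2 hg3), mul_nonneg (mul_nonneg hg0 hz) (sub_nonneg.2 hg3)]
    _ ≤ _ := by linarith

lemma jack_le_mid (hN : 64 ≤ N) (hu1 : 1 / 4 ≤ |u|) (hu2 : |u| ≤ 2 / 5) :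
    jack N u ≤ 0.662 := by
  wlog hpos : 0 < u generalizing u
  · have hneg : u < 0 := by
      rcases lt_or_eq_of_le (not_lt.1 hpos) with h | h
      · exact h
      · simp [h] at hu1; norm_num at hu1
    have := this (u := -u) (by rwa [abs_neg]) (by rwa [abs_neg]) (by linarith)
    rwa [jack_neg] at this
  rw [abs_of_pos hpos] at hu1 hu2
  obtain ⟨h0, h1⟩ := sin_mul_cosecScaled_le hN hpos (by linarith)
  obtain ⟨hg1, hg2⟩ := pi_mul_sq_bounds u
  rw [jack, ← mul_pow]
  have e4 : (π * u) ^ 4 = ((π * u) ^ 2) ^ 2 := by ring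
  rw [e4] at h1
  have hg3 : 0.6168 ≤ (π * u) ^ 2 := by nlinarith
  have hg4 : (π * u) ^ 2 ≤ 1.58 := by nlinarith
  generalize (π * u) ^ 2 = g at *
  have h2 : sin (π * u) * cosecScaled N u ≤ 0.902 := by
    refine h1.trans ?_
    rw [div_le_iff₀ (by linarith)]
    nlinarith
  calc (sin (π * u) * cosecScaled N u) ^ 4 ≤ 0.902 ^ 4 := by gcongr
    _ ≤ _ := by norm_num

lemma scaled_sin_bounds (hN : 64 ≤ N) (hu : 0 < u) (hu1 : u ≤ 1 / 2) :
    sin (π * u / N) ≠ 0 ∧ u - 0.0017 * u ^ 3 ≤ N * (sin (π * u / N) * cos (π * u / N)) / π ∧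
      N * (sin (π * u / N) * cos (π * u / N)) / π ≤ u := by
  have hN' : (64 : ℝ) ≤ N := by exact_mod_cast hN
  have hN0 : (0 : ℝ) < N := by linarith
  have hθ : 0 < π * u / N := by positivity
  have hθ2 : π * u / N < π := by
    rw [div_lt_iff₀ hN0]
    nlinarith [pi_pos]
  refine ⟨(sin_pos_of_pos_of_lt_pi hθ hθ2).ne', ?_⟩
  have h1 : sin (π * u / N) * cos (π * u / N) = sin (2 * (π * u / N)) / 2 := by
    rw [sin_two_mul]; ring
  rw [h1]
  have h2 := sub_cube_div_six_le_sin (x := 2 * (π * u / N)) (by positivity)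
  have h3 := sin_le (x := 2 * (π * u / N)) (by positivity)
  constructor
  · rw [le_div_iff₀ pi_pos]
    have h4 : N * ((2 * (π * u / N) - (2 * (π * u / N)) ^ 3 / 6) / 2) =
        (u - 2 / 3 * π ^ 2 * u ^ 3 / N ^ 2) * π := by field_simp; ring
    have h5 : 2 / 3 * π ^ 2 * u ^ 3 / N ^ 2 ≤ 0.0017 * u ^ 3 := by
      rw [div_le_iff₀ (by positivity)]
      have h6 : 2 / 3 * π ^ 2 ≤ 0.0017 * (N : ℝ) ^ 2 := by nlinarith [pi_lt_d4, pi_pos]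
      have h7 : 0 ≤ u ^ 3 := by positivity
      nlinarith
    calc (u - 0.0017 * u ^ 3) * π ≤ (u - 2 / 3 * π ^ 2 * u ^ 3 / N ^ 2) * π := by
          gcongr
      _ = _ := h4.symm
      _ ≤ _ := by gcongr
  · rw [div_le_iff₀ pi_pos]
    calc (N : ℝ) * (sin (2 * (π * u / N)) / 2) ≤ N * (2 * (π * u / N) / 2) := by gcongr
      _ = _ := by field_simp

lemma abs_jackOdd_le_mul (hN : 64 ≤ N) (hu1 : |u| ≤ 1 / 2) :
    |jackOdd N u| ≤ jack N u * |u| := by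
  rcases eq_or_ne u 0 with rfl | hu0
  · simp [jackOdd]
  wlog hpos : 0 < u generalizing u
  · have := this (u := -u) (by rwa [abs_neg]) (by simpa) (by
      rcases lt_or_gt_of_ne hu0 with h | h <;> linarith)
    rwa [jackOdd_neg, jack_neg, abs_neg, abs_neg] at this
  rw [abs_of_pos hpos] at hu1 ⊢
  obtain ⟨h0, h1, h2⟩ := scaled_sin_bounds hN hpos hu1
  have h3 := jack_nonneg N u
  rw [jackOdd_eq_mul h0, abs_mul, abs_of_nonneg h3]
  gcongr
  rw [abs_of_nonneg]
  · exact h2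
  · refine le_trans ?_ h1
    have : u ^ 2 ≤ 1 := by nlinarith
    nlinarith

lemma abs_jackOdd_sub_le (hN : 64 ≤ N) (hu : |u| ≤ 1 / 4) (hu0 : u ≠ 0) :
    |jackOdd N u - u| ≤ 1 / 4 * (1 - jack N u) + 0.0005 * u ^ 2 := by
  wlog hpos : 0 < u generalizing u
  · have := this (u := -u) (by rwa [abs_neg]) (by simpa) (by
      rcases lt_or_gt_of_ne hu0 with h | h <;> linarith)
    rw [jackOdd_neg, jack_neg, neg_sq] at this
    rwa [← neg_sub', abs_neg] at this
  have hK1 : jack N u ≤ 1 := (jack_le_near hN hu hu0).trans (by nlinarith [sq_nonneg u])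
  rw [abs_of_pos hpos] at hu
  obtain ⟨h0, h1, h2⟩ := scaled_sin_bounds hN hpos (by linarith)
  have h3 := jack_nonneg N u
  rw [jackOdd_eq_mul h0]
  generalize N * (sin (π * u / N) * cos (π * u / N)) / π = T at *
  have hu3 : u ^ 3 ≤ 1 / 4 * u ^ 2 := by nlinarith [sq_nonneg u]
  have h4 : jack N u * T ≤ u := by nlinarith
  rw [abs_of_nonpos (by linarith)]
  have h5 : jack N u * (u - T) ≤ 1 * (0.0017 * u ^ 3) := by
    have : 0 ≤ u - T := by linarith
    gcongr
    linarith
  -- With K = `jack N u`: u - K T = u(1 - K) + K(u - T), where u ≤ 1/4 and K(u - T) ≤ 0.0017 u³.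
  nlinarith

end Central

/-! ### A second order Taylor bound and a block-diagonally dominant system -/

section Tools

lemma norm_taylor_le_of_nonneg {E : Type*} [NormedAddCommGroup E] [NormedSpace ℝ E]
    {f f' f'' : ℝ → E} {r B : ℝ}
    (hf : ∀ t, |t| ≤ r → HasDerivAt f (f' t) t) (hf' : ∀ t, |t| ≤ r → HasDerivAt f' (f'' t) t)
    (hB : ∀ t, |t| ≤ r → ‖f'' t‖ ≤ B) {d : ℝ} (hd0 : 0 ≤ d) (hd : d ≤ r) :
    ‖f d - f 0 - d • f' 0‖ ≤ B * d ^ 2 / 2 := by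
  have habs : ∀ t ∈ Set.Icc 0 d, |t| ≤ r := fun t ht => by
    rw [abs_of_nonneg ht.1]; exact ht.2.trans hd
  have h1 : ∀ t ∈ Set.Icc 0 d, ‖f' t - f' 0‖ ≤ B * (t - 0) :=
    norm_image_sub_le_of_norm_deriv_le_segment'
      (fun t ht => (hf' t (habs t ht)).hasDerivWithinAt)
      (fun t ht => hB t (habs t ⟨ht.1, ht.2.le⟩))
  have hg : ∀ t, |t| ≤ r → HasDerivAt (fun t => f t - f 0 - t • f' 0) (f' t - f' 0) t :=
    fun t ht => by
      have := ((hf t ht).sub_const (f 0)).fun_sub ((hasDerivAt_id t).smul_const (f' 0))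
      simpa using this
  have hb : ∀ t : ℝ, HasDerivAt (fun t => B * t ^ 2 / 2) (B * t) t := fun t => by
    refine (((hasDerivAt_pow 2 t).const_mul B).div_const 2).congr_deriv ?_
    push_cast; ring
  exact image_norm_le_of_norm_deriv_right_le_deriv_boundary (a := 0) (b := d)
    (fun t ht => (hg t (habs t ht)).continuousAt.continuousWithinAt)
    (fun t ht => (hg t (habs t ⟨ht.1, ht.2.le⟩)).hasDerivWithinAt) (by simp) hb
    (fun t ht => by simpa using h1 t ⟨ht.1, ht.2.le⟩) ⟨hd0, le_rfl⟩

lemma norm_taylor_le {E : Type*} [NormedAddCommGroup E] [NormedSpace ℝ E]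
    {f f' f'' : ℝ → E} {r B : ℝ}
    (hf : ∀ t, |t| ≤ r → HasDerivAt f (f' t) t) (hf' : ∀ t, |t| ≤ r → HasDerivAt f' (f'' t) t)
    (hB : ∀ t, |t| ≤ r → ‖f'' t‖ ≤ B) {d : ℝ} (hd : |d| ≤ r) :
    ‖f d - f 0 - d • f' 0‖ ≤ B * d ^ 2 / 2 := by
  rcases le_total 0 d with h | h
  · exact norm_taylor_le_of_nonneg hf hf' hB h ((le_abs_self d).trans hd)
  · have := norm_taylor_le_of_nonneg (f := fun t => f (-t)) (f' := fun t => -f' (-t))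
      (f'' := fun t => f'' (-t)) (r := r) (B := B) (d := -d)
      (fun t ht => by
        have := (hf (-t) (by rwa [abs_neg])).scomp t (hasDerivAt_neg t)
        simpa [Function.comp_def] using this)
      (fun t ht => by
        have := ((hf' (-t) (by rwa [abs_neg])).scomp t (hasDerivAt_neg t)).fun_neg
        simpa [Function.comp_def] using this)
      (fun t ht => hB (-t) (by rwa [abs_neg])) (by linarith) ((neg_le_abs d).trans hd)
    simpa using this

lemma norm_mulVec_le {ι : Type*} [Fintype ι] (A : Matrix ι ι ℂ) {a : ℝ}
    (ha0 : 0 ≤ a) (ha : ∀ i, ∑ j, ‖A i j‖ ≤ a) (x : ι → ℂ) : ‖A.mulVec x‖ ≤ a * ‖x‖ := by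
  refine (pi_norm_le_iff_of_nonneg (by positivity)).2 fun i => ?_
  calc ‖∑ j, A i j * x j‖ ≤ ∑ j, ‖A i j * x j‖ := norm_sum_le _ _
    _ ≤ ∑ j, ‖A i j‖ * ‖x‖ := by
      refine Finset.sum_le_sum fun j _ => ?_
      rw [norm_mul]
      gcongr
      exact norm_le_pi_norm x j
    _ = (∑ j, ‖A i j‖) * ‖x‖ := (Finset.sum_mul ..).symm
    _ ≤ _ := by gcongr; exact ha i

/-- Solvability of the interpolation system, with bounds on the solution. -/
lemma exists_solution_of_row_sums {ι : Type*} [Fintype ι] (A B C D : Matrix ι ι ℂ)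
    (hA : ∀ i, ∑ j, ‖A i j‖ ≤ 0.027) (hB : ∀ i, ∑ j, ‖B i j‖ ≤ 0.027)
    (hC : ∀ i, ∑ j, ‖C i j‖ ≤ 0.217) (hD : ∀ i, ∑ j, ‖D i j‖ ≤ 0.19)
    (v : ι → ℂ) (hv : ‖v‖ ≤ 1) :
    ∃ α β : ι → ℂ, α + (A.mulVec α + B.mulVec β) = v ∧ β + (C.mulVec α + D.mulVec β) = 0 ∧
      ‖α - v‖ ≤ 0.036 ∧ ‖β‖ ≤ 0.28 := by
  -- A priori bounds for any solution: ‖β‖ ≤ (0.217/0.81)‖α‖, and then ‖α‖ ≤ 1.036‖v‖. The case v =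
  -- 0 gives injectivity, hence solvability in finite dimension.
  have bound : ∀ α β v : ι → ℂ, α + (A.mulVec α + B.mulVec β) = v →
      β + (C.mulVec α + D.mulVec β) = 0 →
      ‖α - v‖ ≤ 0.036 * ‖v‖ ∧ ‖β‖ ≤ 0.28 * ‖v‖ ∧ ‖α‖ ≤ 1.036 * ‖v‖ := by
    intro α β v h1 h2
    have e1 : α - v = -(A.mulVec α + B.mulVec β) := by rw [← h1]; abel
    have e2 : β = -(C.mulVec α + D.mulVec β) := eq_neg_of_add_eq_zero_left h2
    have n1 : ‖α - v‖ ≤ 0.027 * ‖α‖ + 0.027 * ‖β‖ := by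
      rw [e1, norm_neg]
      exact (norm_add_le _ _).trans (add_le_add (norm_mulVec_le A (by norm_num) hA α)
        (norm_mulVec_le B (by norm_num) hB β))
    have n2 : ‖β‖ ≤ 0.217 * ‖α‖ + 0.19 * ‖β‖ := by
      conv_lhs => rw [e2, norm_neg]
      exact (norm_add_le _ _).trans (add_le_add (norm_mulVec_le C (by norm_num) hC α)
        (norm_mulVec_le D (by norm_num) hD β))
    have n3 : ‖α‖ ≤ ‖v‖ + ‖α - v‖ := by
      calc ‖α‖ = ‖v + (α - v)‖ := by rw [add_sub_cancel]
        _ ≤ _ := norm_add_le _ _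
    refine ⟨?_, ?_, ?_⟩ <;> linarith [norm_nonneg v, norm_nonneg α, norm_nonneg β]
  let L : (ι → ℂ) × (ι → ℂ) →ₗ[ℂ] (ι → ℂ) × (ι → ℂ) :=
    (LinearMap.fst ℂ _ _ + (A.mulVecLin ∘ₗ LinearMap.fst ℂ _ _ +
      B.mulVecLin ∘ₗ LinearMap.snd ℂ _ _)).prod
    (LinearMap.snd ℂ _ _ + (C.mulVecLin ∘ₗ LinearMap.fst ℂ _ _ +
      D.mulVecLin ∘ₗ LinearMap.snd ℂ _ _))
  have hL : ∀ x, L x = (x.1 + (A.mulVec x.1 + B.mulVec x.2),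
      x.2 + (C.mulVec x.1 + D.mulVec x.2)) := fun x => rfl
  have hinj : Function.Injective L := by
    rw [← LinearMap.ker_eq_bot, LinearMap.ker_eq_bot']
    rintro ⟨α, β⟩ h
    rw [hL, Prod.mk_eq_zero] at h
    obtain ⟨-, h2, h3⟩ := bound α β 0 h.1 h.2
    rw [norm_zero, mul_zero] at h2 h3
    rw [Prod.mk_eq_zero]
    exact ⟨norm_le_zero_iff.1 h3, norm_le_zero_iff.1 h2⟩
  obtain ⟨⟨α, β⟩, h⟩ := LinearMap.injective_iff_surjective.1 hinj (v, 0)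
  rw [hL, Prod.mk.injEq] at h
  obtain ⟨h1, h2, -⟩ := bound α β v h.1 h.2
  exact ⟨α, β, h.1, h.2, h1.trans (by linarith), h2.trans (by linarith)⟩

end Tools

/-! ### The interpolating trigonometric polynomial -/

section Interpolation

open Real

/-- `N` times a representative in `[-1/2, 1/2]` of a point of the circle. -/
noncomputable def scaledLift (N : ℕ) (x : Torus) : ℝ := N * (exists_lift x).choose

variable {N : ℕ}

lemma coe_scaledLift_div (hN : 64 ≤ N) (x : Torus) : ((scaledLift N x / N : ℝ) : Torus) = x := by
  have hN' : (N : ℝ) ≠ 0 := by exact_mod_cast (by omega : N ≠ 0)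
  rw [scaledLift, mul_div_cancel_left₀ _ hN']
  exact (exists_lift x).choose_spec.1

lemma abs_scaledLift (N : ℕ) (x : Torus) : |scaledLift N x| = N * ‖x‖ := by
  rw [scaledLift, abs_mul, (exists_lift x).choose_spec.2, Nat.abs_cast]

lemma scaledLift_ne_zero (hN : 64 ≤ N) {x : Torus} (hx : x ≠ 0) : scaledLift N x ≠ 0 := by
  intro h
  apply hx
  rw [← coe_scaledLift_div hN x, h, zero_div, AddCircle.coe_zero]

lemma one_le_of_mem_erase {S : Finset Torus} (hsep : ∀ s ∈ S, ∀ t ∈ S, s ≠ t → 1 ≤ N * ‖s - t‖)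
    {s t : Torus} (hs : s ∈ S) (ht : t ∈ S.erase s) : 1 ≤ N * ‖s - t‖ :=
  hsep s hs t (Finset.mem_of_mem_erase ht) (Finset.ne_of_mem_erase ht).symm

/-- Decay of the kernel at the other nodes, seen from a node. -/
lemma decay_at_node (hN : 64 ≤ N) {x : Torus} (hx : 1 ≤ N * ‖x‖) :
    |cosecScaled N (scaledLift N x)| ≤ 0.3185 ∧ sin (π * scaledLift N x / N) ≠ 0 := by
  have h := abs_cosecScaled_le (N := N) (by omega) (u := scaledLift N x) (r := 1) one_pos
    (by rwa [coe_scaledLift_div hN])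
  refine ⟨h.1.trans ((cosecScaled_le_of_small hN one_pos le_rfl).trans (by norm_num)), h.2.1⟩

lemma sum_decay_at_point (hN : 64 ≤ N) (T : Finset Torus)
    (hsep : ∀ s ∈ T, ∀ t ∈ T, s ≠ t → 1 ≤ N * ‖s - t‖) (y : Torus)
    (hy : ∀ t ∈ T, 1 ≤ N * ‖y - t‖) :
    ∑ t ∈ T, |cosecScaled N (scaledLift N (y - t))| ^ 3 ≤ 0.084 := by
  refine (sum_cosecScaled_pow_le hN le_rfl (by norm_num) T hsep y _ fun t ht => ?_).trans
    binWeight_sum_zero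
  rw [coe_scaledLift_div hN, norm_sub_rev t y, sub_zero]
  exact ⟨hy t ht, le_rfl⟩

lemma sum_abs_le_of_decay (hN : 64 ≤ N) {S : Finset Torus}
    (hsep : ∀ s ∈ S, ∀ t ∈ S, s ≠ t → 1 ≤ N * ‖s - t‖) {s : Torus} (hs : s ∈ S)
    {F : ℝ → ℝ} {c : ℝ} (hc : 0 ≤ c)
    (hF : ∀ u, |cosecScaled N u| ≤ 0.3185 → sin (π * u / N) ≠ 0 →
      |F u| ≤ c * |cosecScaled N u| ^ 3) :
    ∑ t ∈ S.erase s, |F (scaledLift N (s - t))| ≤ c * 0.084 := by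
  have h1 := sum_decay_at_point hN (S.erase s)
    (fun a ha b hb => hsep a (Finset.mem_of_mem_erase ha) b (Finset.mem_of_mem_erase hb)) s
    fun t ht => one_le_of_mem_erase hsep hs ht
  refine (Finset.sum_le_sum fun t ht => ?_).trans
    ((Finset.mul_sum ..).symm.le.trans (mul_le_mul_of_nonneg_left h1 hc))
  obtain ⟨h2, h3⟩ := decay_at_node hN (one_le_of_mem_erase hsep hs ht)
  exact hF _ h2 h3

lemma sum_subtype_ite_eq {R : Type*} [AddCommMonoid R] (S : Finset Torus) (i : S) (G : Torus → R) :
    ∑ j : S, (if i = j then 0 else G j) = ∑ t ∈ S.erase i, G t := by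
  have h : ∀ j : S, (if i = j then 0 else G j) =
      (fun t : Torus => if (i : Torus) = t then 0 else G t) j := fun j => by
    simp only [Subtype.coe_inj]
  rw [Finset.sum_congr rfl fun j _ => h j,
    Finset.sum_coe_sort S (fun t : Torus => if (i : Torus) = t then 0 else G t),
    ← Finset.add_sum_erase S _ i.2, if_pos rfl, zero_add]
  exact Finset.sum_congr rfl fun t ht => if_neg (Finset.ne_of_mem_erase ht).symm

/-- The matrix of values of `F` at the differences of distinct nodes. -/
noncomputable def nodeMatrix (N : ℕ) (S : Finset Torus) (F : ℝ → ℝ) : Matrix S S ℂ :=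
  fun i j => if i = j then 0 else (F (scaledLift N (i - j)) : ℂ)

lemma nodeMatrix_mulVec (N : ℕ) (S : Finset Torus) (F : ℝ → ℝ) (x : Torus → ℂ) (i : S) :
    (nodeMatrix N S F).mulVec (fun j => x j) i =
      ∑ t ∈ S.erase i, x t * F (scaledLift N (i - t)) := by
  rw [← sum_subtype_ite_eq]
  refine Finset.sum_congr rfl fun j _ => ?_
  simp only [nodeMatrix]
  split_ifs <;> ring

lemma nodeMatrix_row_sum (N : ℕ) (S : Finset Torus) (F : ℝ → ℝ) (i : S) :
    ∑ j, ‖nodeMatrix N S F i j‖ = ∑ t ∈ S.erase i, |F (scaledLift N (i - t))| := by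
  rw [← sum_subtype_ite_eq]
  refine Finset.sum_congr rfl fun j _ => ?_
  simp only [nodeMatrix]
  split_ifs
  · simp
  · rw [Complex.norm_real, Real.norm_eq_abs]

/-- Coefficients of the interpolating polynomial. -/
lemma exists_coeffs (hN : 64 ≤ N) {S : Finset Torus}
    (hsep : ∀ s ∈ S, ∀ t ∈ S, s ≠ t → 1 ≤ N * ‖s - t‖) (v : Torus → ℂ) (hv : ∀ s, ‖v s‖ ≤ 1) :
    ∃ α β : Torus → ℂ,
      (∀ s ∈ S, α s + ∑ t ∈ S.erase s, (α t * jack N (scaledLift N (s - t)) +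
        β t * jackOdd N (scaledLift N (s - t))) = v s) ∧
      (∀ s ∈ S, β s + ∑ t ∈ S.erase s, (α t * jackDeriv N (scaledLift N (s - t)) +
        β t * jackOddDeriv N (scaledLift N (s - t))) = 0) ∧
      (∀ s ∈ S, ‖α s - v s‖ ≤ 0.036) ∧ ∀ s ∈ S, ‖β s‖ ≤ 0.28 := by
  have hπ1 := pi_gt_d4
  have hπ2 := pi_lt_d4
  -- Between nodes the weight is at most 0.3185, so each entry is at most a constant times its cube,
  -- and the cubes sum to at most 0.084 along a row.
  obtain ⟨α, β, h1, h2, h3, h4⟩ := exists_solution_of_row_sums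
    (nodeMatrix N S (jack N)) (nodeMatrix N S (jackOdd N))
    (nodeMatrix N S (jackDeriv N)) (nodeMatrix N S (jackOddDeriv N))
    (fun i => by
      rw [nodeMatrix_row_sum]
      refine (sum_abs_le_of_decay hN hsep i.2 (c := 0.3185) (by norm_num) fun u hu _ => ?_).trans
        (by norm_num)
      refine (abs_jack_le N u).trans ?_
      rw [pow_succ']
      gcongr)
    (fun i => by
      rw [nodeMatrix_row_sum]
      refine (sum_abs_le_of_decay hN hsep i.2 (c := 0.3185) (by norm_num) fun u hu _ => ?_).trans
        (by norm_num)
      refine (abs_jackOdd_le N u).trans ?_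
      rw [div_le_iff₀ pi_pos]
      have : 0 ≤ |cosecScaled N u| ^ 3 := by positivity
      nlinarith)
    (fun i => by
      rw [nodeMatrix_row_sum]
      refine (sum_abs_le_of_decay hN hsep i.2 (c := 4 * π * 0.3185 * 0.6435) (by positivity)
        fun u hu _ => ?_).trans (by linarith)
      refine (abs_jackDeriv_le N u).trans ?_
      rw [pow_succ']
      calc _ ≤ 4 * π * (0.3185 * |cosecScaled N u| ^ 3) * (0.325 + 0.3185) := by gcongr
        _ = _ := by ring)
    (fun i => by
      rw [nodeMatrix_row_sum]
      refine (sum_abs_le_of_decay hN hsep i.2 (c := 1.3 + 3 * 0.3185) (by norm_num)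
        fun u hu hs => ?_).trans (by norm_num)
      refine (abs_jackOddDeriv_le hs).trans ?_
      rw [pow_succ' _ 3]
      calc _ ≤ 1.3 * |cosecScaled N u| ^ 3 + 3 * (0.3185 * |cosecScaled N u| ^ 3) := by gcongr
        _ = _ := by ring)
    (fun i => v i) ((pi_norm_le_iff_of_nonneg zero_le_one).2 fun i => hv i)
  have hext : ∀ γ : S → ℂ, ∃ γ' : Torus → ℂ, (fun j : S => γ' j) = γ := fun γ =>
    ⟨fun t => if h : t ∈ S then γ ⟨t, h⟩ else 0, by ext j; simp⟩
  obtain ⟨α, rfl⟩ := hext α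
  obtain ⟨β, rfl⟩ := hext β
  refine ⟨α, β, fun s hs => ?_, fun s hs => ?_, fun s hs => ?_, fun s hs => ?_⟩
  · have h := congrFun h1 ⟨s, hs⟩
    rw [Pi.add_apply, Pi.add_apply, nodeMatrix_mulVec, nodeMatrix_mulVec] at h
    rw [Finset.sum_add_distrib]
    exact h
  · have h := congrFun h2 ⟨s, hs⟩
    rw [Pi.add_apply, Pi.add_apply, nodeMatrix_mulVec, nodeMatrix_mulVec] at h
    rw [Finset.sum_add_distrib]
    exact h
  · exact (norm_le_pi_norm ((fun j : S => α j) - fun i : S => v i) ⟨s, hs⟩).trans h3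
  · exact (norm_le_pi_norm (fun j : S => β j) ⟨s, hs⟩).trans h4

/-- The combination of translated kernels with coefficients `α`, `β` at the nodes `S`. -/
noncomputable def kernelSum (N : ℕ) (S : Finset Torus) (α β : Torus → ℂ) (x : Torus) : ℂ :=
  ∑ t ∈ S, (α t * jackT N (x - t) + β t * jackOddT N (x - t))

lemma kernelSum_mem (hN : 64 ≤ N) (S : Finset Torus) (α β : Torus → ℂ) :
    kernelSum N S α β ∈ trigPoly (2 * N - 1) := by
  have : kernelSum N S α β = ∑ t ∈ S, (α t • (fun x => jackT N (x - t)) +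
      β t • (fun x => jackOddT N (x - t))) := by
    ext x; simp [kernelSum]
  rw [this]
  refine Submodule.sum_mem _ fun t _ => Submodule.add_mem _ (Submodule.smul_mem _ _ ?_)
    (Submodule.smul_mem _ _ (comp_sub_mem_trigPoly (jackOddT_mem (by omega)) t))
  exact comp_sub_mem_trigPoly (trigPoly_mono (by omega) (jackT_mem (by omega))) t

lemma kernelSum_apply (hN : 64 ≤ N) {S : Finset Torus} {s : Torus} (hs : s ∈ S)
    {α β : Torus → ℂ} (hsep : ∀ s ∈ S, ∀ t ∈ S, s ≠ t → 1 ≤ N * ‖s - t‖) :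
    kernelSum N S α β s = α s + ∑ t ∈ S.erase s, (α t * jack N (scaledLift N (s - t)) +
        β t * jackOdd N (scaledLift N (s - t))) := by
  rw [kernelSum, ← Finset.add_sum_erase S _ hs, sub_self, jackT_zero (by omega), jackOddT_zero,
    mul_one, mul_zero, add_zero]
  congr 1
  refine Finset.sum_congr rfl fun t ht => ?_
  have h := (decay_at_node hN (one_le_of_mem_erase hsep hs ht)).2
  rw [← jackT_coe h, ← jackOddT_coe h, coe_scaledLift_div hN]

/-- Rewritten as vK + (α - v)(K - 1) + β(H - d), the expression is at most 1 - (1 - 0.036 - 0.07)(1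
- K) up to a tiny d² term, and 1 - K ≥ 5.4 d². -/
lemma central_estimate (hN : 64 ≤ N) {d : ℝ} (hd : |d| ≤ 1 / 4) (hd0 : d ≠ 0) {v α β : ℂ}
    (hv : ‖v‖ ≤ 1) (hα : ‖α - v‖ ≤ 0.036) (hβ : ‖β‖ ≤ 0.28) :
    ‖v + α * ((jack N d : ℂ) - 1) + β * ((jackOdd N d : ℂ) - d)‖ ≤ 1 - 4.8 * d ^ 2 := by
  have h1 := jack_le_near hN hd hd0
  have h2 := abs_jackOdd_sub_le hN hd hd0
  have h0 := jack_nonneg N d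
  have hd2 := sq_nonneg d
  have e : v + α * ((jack N d : ℂ) - 1) + β * ((jackOdd N d : ℂ) - d) =
      v * (jack N d : ℂ) + (α - v) * ((jack N d - 1 : ℝ) : ℂ) +
        β * ((jackOdd N d - d : ℝ) : ℂ) := by push_cast; ring
  rw [e]
  calc _ ≤ ‖v‖ * |jack N d| + ‖α - v‖ * |jack N d - 1| + ‖β‖ * |jackOdd N d - d| := by
        refine (norm_add₃_le).trans_eq ?_
        simp only [norm_mul, Complex.norm_real, Real.norm_eq_abs]
    _ ≤ 1 * jack N d + 0.036 * (1 - jack N d) +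
        0.28 * (1 / 4 * (1 - jack N d) + 0.0005 * d ^ 2) := by
        rw [abs_of_nonneg h0, abs_of_nonpos (by linarith : jack N d - 1 ≤ 0), neg_sub]
        have : 0 ≤ 1 - jack N d := by linarith
        gcongr
    _ ≤ _ := by nlinarith

lemma decay_near_node (hN : 64 ≤ N) {x : Torus} (hx : 1 ≤ N * ‖x‖) {d : ℝ} (hd : |d| ≤ 1 / 4) :
    N * ‖x‖ - 1 / 4 ≤ N * ‖(((scaledLift N x + d) / N : ℝ) : Torus)‖ ∧
    |cosecScaled N (scaledLift N x + d)| ≤ 0.425 ∧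
      sin (π * (scaledLift N x + d) / N) ≠ 0 := by
  have hN' : (0 : ℝ) < N := by exact_mod_cast (by omega : 0 < N)
  have h1 : N * ‖x‖ - 1 / 4 ≤ N * ‖(((scaledLift N x + d) / N : ℝ) : Torus)‖ := by
    have h2 : x = (((scaledLift N x + d) / N : ℝ) : Torus) - ((d / N : ℝ) : Torus) := by
      rw [← AddCircle.coe_sub, ← sub_div, add_sub_cancel_right, coe_scaledLift_div hN]
    have h3 : N * ‖((d / N : ℝ) : Torus)‖ ≤ 1 / 4 := by
      refine (mul_le_mul_of_nonneg_left (norm_coe_le _) hN'.le).trans ?_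
      rw [abs_div, Nat.abs_cast, mul_div_cancel₀ _ hN'.ne']
      exact hd
    have h4 := norm_sub_le (((scaledLift N x + d) / N : ℝ) : Torus) ((d / N : ℝ) : Torus)
    rw [← h2] at h4
    nlinarith
  have h := abs_cosecScaled_le (N := N) (by omega) (u := scaledLift N x + d) (r := 3 / 4)
    (by norm_num) (by linarith)
  exact ⟨h1, h.1.trans ((cosecScaled_le_of_small hN (by norm_num) (by norm_num)).trans
    (by norm_num)), h.2.1⟩

section Bounds

variable {S : Finset Torus} {α β v : Torus → ℂ}

lemma norm_alpha_le (hv : ∀ s, ‖v s‖ ≤ 1) (hα : ∀ s ∈ S, ‖α s - v s‖ ≤ 0.036) :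
    ∀ s ∈ S, ‖α s‖ ≤ 1.036 := fun s hs => by
  have h := norm_add_le (v s) (α s - v s)
  rw [add_sub_cancel] at h
  linarith [hv s, hα s hs]

/-- The second derivative of the contribution of the other nodes near a node. -/
lemma norm_second_deriv_le (hN : 64 ≤ N)
    (hsep : ∀ s ∈ S, ∀ t ∈ S, s ≠ t → 1 ≤ N * ‖s - t‖)
    (hα : ∀ s ∈ S, ‖α s‖ ≤ 1.036) (hβ : ∀ s ∈ S, ‖β s‖ ≤ 0.28) {s : Torus} (hs : s ∈ S)
    {d : ℝ} (hd : |d| ≤ 1 / 4) :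
    ‖∑ t ∈ S.erase s, (α t * jackDeriv₂ N (scaledLift N (s - t) + d) +
      β t * jackOddDeriv₂ N (scaledLift N (s - t) + d))‖ ≤ 7.85 := by
  have hπ1 := pi_gt_d4
  have hπ2 := pi_lt_d4
  have hsum : ∑ t ∈ S.erase s, |cosecScaled N (scaledLift N (s - t) + d)| ^ 3 ≤ 0.182 := by
    refine (sum_cosecScaled_pow_le hN (c := 1 / 4) (by norm_num) (by norm_num) (S.erase s)
      (fun a ha b hb => hsep a (Finset.mem_of_mem_erase ha) b (Finset.mem_of_mem_erase hb)) s
      _ fun t ht => ?_).trans binWeight_sum_quarter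
    have h1 := one_le_of_mem_erase hsep hs ht
    rw [norm_sub_rev t s]
    exact ⟨h1, (decay_near_node hN h1 hd).1⟩
  calc _ ≤ ∑ t ∈ S.erase s, 43.1 * |cosecScaled N (scaledLift N (s - t) + d)| ^ 3 := by
        refine (norm_sum_le _ _).trans (Finset.sum_le_sum fun t ht => ?_)
        obtain ⟨-, h2, h3⟩ := decay_near_node hN (one_le_of_mem_erase hsep hs ht) hd
        have hK := abs_jackDeriv₂_le h3 (h2.trans (by norm_num))
        have hH := abs_jackOddDeriv₂_le h3 (h2.trans (by norm_num))
        have ht' := Finset.mem_of_mem_erase ht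
        refine (norm_add_le _ _).trans ?_
        rw [norm_mul, norm_mul, Complex.norm_real, Complex.norm_real, Real.norm_eq_abs,
          Real.norm_eq_abs]
        rw [pow_succ' _ 3] at hK
        have hw0 := abs_nonneg (cosecScaled N (scaledLift N (s - t) + d))
        generalize |cosecScaled N (scaledLift N (s - t) + d)| = w at *
        calc _ ≤ 1.036 * (4 * π ^ 2 * (0.425 * w ^ 3) * (1 + 2.6 * 0.425)) +
              0.28 * (4 * π * w ^ 3 * (1 + 1.95 * 0.425)) := by
              gcongr
              · exact hα t ht'
              · refine hK.trans ?_
                gcongr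
              · exact hβ t ht'
              · refine hH.trans ?_
                gcongr
          _ = (1.036 * (4 * π ^ 2 * 0.425 * (1 + 2.6 * 0.425)) +
              0.28 * (4 * π * (1 + 1.95 * 0.425))) * w ^ 3 := by ring
          _ ≤ _ := by
              gcongr
              nlinarith
    _ = 43.1 * ∑ t ∈ S.erase s, |cosecScaled N (scaledLift N (s - t) + d)| ^ 3 :=
        (Finset.mul_sum ..).symm
    _ ≤ 43.1 * 0.182 := by gcongr
    _ ≤ _ := by norm_num

end Bounds

end Interpolation

/-! ### Size of the interpolating polynomial near and away from the nodes -/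

section DualBounds

open Real

variable {N : ℕ} {S : Finset Torus} {α β v : Torus → ℂ}

lemma kernel_coe (hN : 64 ≤ N) {x : Torus} (hx : x ≠ 0) :
    sin (π * scaledLift N x / N) ≠ 0 ∧ jackT N x = jack N (scaledLift N x) ∧
      jackOddT N x = jackOdd N (scaledLift N x) := by
  have hN' : (0 : ℝ) < N := by exact_mod_cast (by omega : 0 < N)
  have h := (abs_cosecScaled_le (N := N) (by omega) (u := scaledLift N x) (r := N * ‖x‖)
    (by positivity) (by rw [coe_scaledLift_div hN])).2.1
  refine ⟨h, ?_, ?_⟩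
  · rw [← jackT_coe h, coe_scaledLift_div hN]
  · rw [← jackOddT_coe h, coe_scaledLift_div hN]

/-- Quadratic decay of the interpolating polynomial near a node. -/
lemma norm_kernelSum_le_near (hN : 64 ≤ N)
    (hsep : ∀ s ∈ S, ∀ t ∈ S, s ≠ t → 1 ≤ N * ‖s - t‖) (hv : ∀ s, ‖v s‖ ≤ 1)
    (h1 : ∀ s ∈ S, α s + ∑ t ∈ S.erase s, (α t * jack N (scaledLift N (s - t)) +
        β t * jackOdd N (scaledLift N (s - t))) = v s)
    (h2 : ∀ s ∈ S, β s + ∑ t ∈ S.erase s, (α t * jackDeriv N (scaledLift N (s - t)) +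
        β t * jackOddDeriv N (scaledLift N (s - t))) = 0)
    (hα : ∀ s ∈ S, ‖α s - v s‖ ≤ 0.036) (hβ : ∀ s ∈ S, ‖β s‖ ≤ 0.28)
    {s x : Torus} (hs : s ∈ S) (hx : N * ‖x - s‖ ≤ 1 / 4) :
    ‖kernelSum N S α β x‖ ≤ 1 - 0.3 * (N * ‖x - s‖) ^ 2 := by
  rcases eq_or_ne x s with rfl | hxs
  · rw [kernelSum_apply hN hs hsep, h1 x hs, sub_self, norm_zero]
    simpa using hv x
  set d := scaledLift N (x - s) with hd
  have hdabs : |d| = N * ‖x - s‖ := abs_scaledLift N _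
  rw [← hdabs, sq_abs]
  rw [← hdabs] at hx
  have hd0 : d ≠ 0 := scaledLift_ne_zero hN (sub_ne_zero.2 hxs)
  set R : ℝ → ℂ := fun y => ∑ t ∈ S.erase s, (α t * jack N (scaledLift N (s - t) + y) +
    β t * jackOdd N (scaledLift N (s - t) + y)) with hR
  set R' : ℝ → ℂ := fun y => ∑ t ∈ S.erase s, (α t * jackDeriv N (scaledLift N (s - t) + y) +
    β t * jackOddDeriv N (scaledLift N (s - t) + y)) with hR'
  have hsin : ∀ y : ℝ, |y| ≤ 1 / 4 → ∀ t ∈ S.erase s,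
      sin (π * (scaledLift N (s - t) + y) / N) ≠ 0 := fun y hy t ht =>
    (decay_near_node hN (one_le_of_mem_erase hsep hs ht) hy).2.2
  have hT := norm_taylor_le (f := R) (f' := R') (r := 1 / 4) (B := 7.85)
    (fun y hy => HasDerivAt.fun_sum fun t ht =>
      (((hasDerivAt_jack (hsin y hy t ht)).comp_const_add _ y).ofReal_comp.const_mul (α t)).fun_add
      (((hasDerivAt_jackOdd (hsin y hy t ht)).comp_const_add _ y).ofReal_comp.const_mul (β t)))
    (fun y hy => HasDerivAt.fun_sum fun t ht =>
      (((hasDerivAt_jackDeriv (hsin y hy t ht)).comp_const_add _ y).ofReal_comp.const_mul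
        (α t)).fun_add
      (((hasDerivAt_jackOddDeriv (hsin y hy t ht)).comp_const_add _ y).ofReal_comp.const_mul
        (β t)))
    (fun y hy => norm_second_deriv_le hN hsep (norm_alpha_le hv hα) hβ hs hy) hx
  have hR0 : R 0 = v s - α s := by
    rw [← h1 s hs, add_sub_cancel_left]; simp [hR]
  have hR0' : R' 0 = -β s := by
    rw [eq_neg_iff_add_eq_zero, add_comm, ← h2 s hs]; simp [hR']
  obtain ⟨-, hK, hH⟩ := kernel_coe hN (sub_ne_zero.2 hxs)
  have hq : kernelSum N S α β x = α s * jack N d + β s * jackOdd N d + R d := by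
    rw [kernelSum, ← Finset.add_sum_erase S _ hs, hK, hH]
    congr 1
    refine Finset.sum_congr rfl fun t ht => ?_
    have e : x - t = (((scaledLift N (s - t) + d) / N : ℝ) : Torus) := by
      rw [add_div, AddCircle.coe_add, coe_scaledLift_div hN, hd, coe_scaledLift_div hN]
      abel
    rw [e, jackT_coe (hsin d hx t ht), jackOddT_coe (hsin d hx t ht)]
  have hc := central_estimate hN hx hd0 (hv s) (hα s hs) (hβ s hs)
  -- The interpolation conditions say R(0) = v - α and R'(0) = -β, so the first order part of R
  -- recentres K and H at 1 and d. The remainder costs 7.85 d²/2, less than the gain 4.8 d².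
  have hsplit : kernelSum N S α β x = (v s + α s * ((jack N d : ℂ) - 1) +
      β s * ((jackOdd N d : ℂ) - d)) + (R d - R 0 - d • R' 0) := by
    rw [hq, hR0, hR0', Complex.real_smul]; ring
  rw [hsplit]
  refine (norm_add_le _ _).trans ((add_le_add hc hT).trans ?_)
  nlinarith [sq_nonneg d]

/-- The size of a single term away from its node. -/
lemma norm_term_le (hN : 64 ≤ N) {a b : ℂ} (ha : ‖a‖ ≤ 1.036) (hb : ‖b‖ ≤ 0.28) {x : Torus} :
    (1 / 4 ≤ N * ‖x‖ → ‖a * jackT N x + b * jackOddT N x‖ ≤ 0.77) ∧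
    (2 / 5 ≤ N * ‖x‖ → ‖a * jackT N x + b * jackOddT N x‖ ≤ 0.464) ∧
    (3 / 5 ≤ N * ‖x‖ → ‖a * jackT N x + b * jackOddT N x‖ ≤ 0.1) ∧
    (1 ≤ N * ‖x‖ → ‖a * jackT N x + b * jackOddT N x‖ ≤
      0.42 * |cosecScaled N (scaledLift N x)| ^ 3) := by
  have hπ1 := pi_gt_d4
  have hterm : x ≠ 0 → ‖a * jackT N x + b * jackOddT N x‖ ≤
      1.036 * jack N (scaledLift N x) + 0.28 * |jackOdd N (scaledLift N x)| := fun hx => by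
    obtain ⟨-, h1, h2⟩ := kernel_coe hN hx
    rw [h1, h2]
    refine (norm_add_le _ _).trans ?_
    rw [norm_mul, norm_mul, Complex.norm_real, Complex.norm_real, Real.norm_eq_abs,
      Real.norm_eq_abs, abs_of_nonneg (jack_nonneg _ _)]
    have := jack_nonneg N (scaledLift N x)
    gcongr
  have hne : ∀ r : ℝ, 0 < r → r ≤ N * ‖x‖ → x ≠ 0 := by
    rintro r hr h rfl
    rw [norm_zero, mul_zero] at h
    linarith
  have hdecay : ∀ r w : ℝ, 0 < r → r ≤ 1 → (3.1402 * r)⁻¹ ≤ w → r ≤ N * ‖x‖ →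
      ‖a * jackT N x + b * jackOddT N x‖ ≤
        (1.036 * w + 0.28 / π) * |cosecScaled N (scaledLift N x)| ^ 3 ∧
      |cosecScaled N (scaledLift N x)| ≤ w := by
    intro r w hr hr1 hw h
    have h1 := (abs_cosecScaled_le (N := N) (by omega) (u := scaledLift N x) hr
      (by rwa [coe_scaledLift_div hN])).1.trans ((cosecScaled_le_of_small hN hr hr1).trans hw)
    refine ⟨(hterm (hne r hr h)).trans ?_, h1⟩
    have h2 := (le_abs_self _).trans (abs_jack_le N (scaledLift N x))
    have h3 := abs_jackOdd_le N (scaledLift N x)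
    rw [pow_succ'] at h2
    calc _ ≤ 1.036 * (w * |cosecScaled N (scaledLift N x)| ^ 3) +
          0.28 * (|cosecScaled N (scaledLift N x)| ^ 3 / π) := by
          gcongr
          exact h2.trans (by gcongr)
      _ = _ := by ring
  have hinv : 0.28 / π ≤ 0.0892 := by
    rw [div_le_iff₀ pi_pos]; linarith
  have hfar : ∀ r w C : ℝ, 0 < r → r ≤ 1 → (3.1402 * r)⁻¹ ≤ w → 0 ≤ w →
      (1.036 * w + 0.0892) * w ^ 3 ≤ C →
      r ≤ N * ‖x‖ → ‖a * jackT N x + b * jackOddT N x‖ ≤ C := by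
    intro r w C hr hr1 hw hw0 hC h
    obtain ⟨h1, h2⟩ := hdecay r w hr hr1 hw h
    refine h1.trans (le_trans ?_ hC)
    gcongr
  have h2 : 2 / 5 ≤ N * ‖x‖ → ‖a * jackT N x + b * jackOddT N x‖ ≤ 0.464 :=
    hfar (2 / 5) 0.797 _ (by norm_num) (by norm_num) (by norm_num) (by norm_num) (by norm_num)
  refine ⟨fun h => ?_, h2, hfar (3 / 5) 0.532 _ (by norm_num) (by norm_num) (by norm_num)
    (by norm_num) (by norm_num), fun h => ?_⟩
  -- Below 2/5 the power bounds in the weight are too weak, so the direct bound on K over [1/4, 2/5]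
  -- is used.
  · rcases le_total (2 / 5) ((N : ℝ) * ‖x‖) with h' | h'
    · exact (h2 h').trans (by norm_num)
    · have habs := abs_scaledLift N x
      have h3 := jack_le_mid hN (u := scaledLift N x) (by linarith) (by linarith)
      have h4 := abs_jackOdd_le_mul hN (u := scaledLift N x) (by linarith)
      have h0 := jack_nonneg N (scaledLift N x)
      refine (hterm (hne _ (by norm_num) h)).trans ?_
      have h5 : jack N (scaledLift N x) * |scaledLift N x| ≤ 0.662 * (2 / 5) := by
        gcongr; linarith
      linarith
  · refine (hdecay 1 0.3185 one_pos le_rfl (by norm_num) h).1.trans ?_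
    gcongr
    linarith

/-- Uniform bound for the interpolating polynomial away from the nodes. -/
lemma norm_kernelSum_le_far (hN : 64 ≤ N)
    (hsep : ∀ s ∈ S, ∀ t ∈ S, s ≠ t → 1 ≤ N * ‖s - t‖)
    (hα : ∀ s ∈ S, ‖α s‖ ≤ 1.036) (hβ : ∀ s ∈ S, ‖β s‖ ≤ 0.28)
    {x : Torus} (hx : ∀ s ∈ S, 1 / 4 ≤ N * ‖x - s‖) :
    ‖kernelSum N S α β x‖ ≤ 0.97 := by
  classical
  set f : Torus → ℝ := fun t => ‖α t * jackT N (x - t) + β t * jackOddT N (x - t)‖ with hf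
  have hterm : ∀ t ∈ S, _ := fun t ht => norm_term_le hN (hα t ht) (hβ t ht) (x := x - t)
  refine (norm_sum_le _ _).trans ?_
  rw [← Finset.sum_filter_add_sum_filter_not S (fun t => 1 ≤ N * ‖x - t‖)]
  have hfarsum : ∑ t ∈ S.filter (fun t => 1 ≤ N * ‖x - t‖), f t ≤ 0.0353 := by
    have h1 := sum_decay_at_point hN (S.filter (fun t => 1 ≤ N * ‖x - t‖))
      (fun a ha b hb => hsep a (Finset.mem_filter.1 ha).1 b (Finset.mem_filter.1 hb).1) x
      fun t ht => (Finset.mem_filter.1 ht).2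
    calc _ ≤ ∑ t ∈ S.filter (fun t => 1 ≤ N * ‖x - t‖),
          0.42 * |cosecScaled N (scaledLift N (x - t))| ^ 3 := Finset.sum_le_sum fun t ht =>
            (hterm t (Finset.mem_filter.1 ht).1).2.2.2 (Finset.mem_filter.1 ht).2
      _ = 0.42 * ∑ t ∈ S.filter (fun t => 1 ≤ N * ‖x - t‖),
          |cosecScaled N (scaledLift N (x - t))| ^ 3 := (Finset.mul_sum ..).symm
      _ ≤ 0.42 * 0.084 := by gcongr
      _ ≤ _ := by norm_num
  set T := S.filter (fun t => ¬1 ≤ N * ‖x - t‖) with hT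
  have hTS : ∀ t ∈ T, t ∈ S := fun t ht => (Finset.mem_filter.1 ht).1
  -- The bin estimate applied to the indicator of bin 0.
  have hcard : (T.card : ℝ) ≤ 2 := by
    have h := sum_le_of_separated T (fun a ha b hb => hsep a (hTS a ha) b (hTS b hb)) x
      (φ := fun k => if k = 0 then 1 else 0) (fun k => by split_ifs <;> norm_num)
      (f := fun _ => 1) fun t ht => by
        have h1 := (Finset.mem_filter.1 ht).2
        rw [norm_sub_rev, if_pos (Nat.floor_eq_zero.2 (not_le.1 h1))]
    simpa using h
  have hnear : ∑ t ∈ T, f t ≤ 0.93 := by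
    -- A node within 2/5 forces the other to be at least 3/5 away: 0.77 + 0.1. Otherwise both are
    -- beyond 2/5: 2 · 0.464 = 0.928.
    by_cases hex : ∃ s ∈ T, N * ‖x - s‖ ≤ 2 / 5
    · obtain ⟨s, hs, hs2⟩ := hex
      rw [← Finset.add_sum_erase T _ hs]
      have h1 : f s ≤ 0.77 := (hterm s (hTS s hs)).1 (hx s (hTS s hs))
      have h2 : ∑ t ∈ T.erase s, f t ≤ (T.erase s).card • 0.1 := by
        refine Finset.sum_le_card_nsmul _ _ _ fun t ht => ?_
        have ht' := hTS t (Finset.mem_of_mem_erase ht)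
        refine (hterm t ht').2.2.1 ?_
        have h3 := hsep s (hTS s hs) t ht' (Finset.ne_of_mem_erase ht).symm
        have h4 : ‖s - t‖ ≤ ‖x - s‖ + ‖x - t‖ := by
          rw [← sub_sub_sub_cancel_left, add_comm]
          exact norm_sub_le _ _
        have h5 : (N : ℝ) * ‖s - t‖ ≤ N * (‖x - s‖ + ‖x - t‖) := by gcongr
        linarith
      rw [Finset.card_erase_of_mem hs, nsmul_eq_mul,
        Nat.cast_pred (Finset.card_pos.2 ⟨s, hs⟩)] at h2
      linarith
    · push Not at hex
      have h2 : ∑ t ∈ T, f t ≤ T.card • 0.464 := Finset.sum_le_card_nsmul _ _ _ fun t ht =>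
        (hterm t (hTS t ht)).2.1 (hex t ht).le
      rw [nsmul_eq_mul] at h2
      linarith
  linarith

end DualBounds

/-! ### The dual polynomial and the main estimate -/

/-- Existence of dual certificates under the separation condition. -/
theorem exists_dual_polynomial {N : ℕ} (hN : 64 ≤ N) {S : Finset Torus}
    (hsep : ∀ s ∈ S, ∀ t ∈ S, s ≠ t → 1 ≤ N * ‖s - t‖) (v : Torus → ℂ) (hv : ∀ s, ‖v s‖ ≤ 1) :
    ∃ q ∈ trigPoly (2 * N - 1), (∀ s ∈ S, q s = v s) ∧
      (∀ s ∈ S, ∀ x, N * ‖x - s‖ ≤ 1 / 4 → ‖q x‖ ≤ 1 - 0.3 * (N * ‖x - s‖) ^ 2) ∧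
      ∀ x, (∀ s ∈ S, 1 / 4 ≤ N * ‖x - s‖) → ‖q x‖ ≤ 0.97 := by
  obtain ⟨α, β, h1, h2, h3, h4⟩ := exists_coeffs hN hsep v hv
  exact ⟨kernelSum N S α β, kernelSum_mem hN S α β,
    fun s hs => by rw [kernelSum_apply hN hs hsep, h1 s hs],
    fun s hs x hx => norm_kernelSum_le_near hN hsep hv h1 h2 h3 h4 hs hx,
    fun x hx => norm_kernelSum_le_far hN hsep (norm_alpha_le hv h3) h4 hx⟩

/-! ### The weight `gap` and its integral against |μ - μ₀| -/

section Weight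

variable {M : ℕ} {S : Finset Torus}

lemma measurableSet_nearPoint (M : ℕ) (s : Torus) : MeasurableSet (nearPoint M s) :=
  (isClosed_le (by fun_prop) continuous_const).measurableSet

lemma measurableSet_nearSet (M : ℕ) (S : Finset Torus) : MeasurableSet (nearSet M S) :=
  Finset.measurableSet_biUnion S fun s _ => measurableSet_nearPoint M s

open Classical in
/-- The gap between `1` and the modulus of the dual polynomials. -/
noncomputable def gap (M : ℕ) (S : Finset Torus) (x : Torus) : ℝ :=
  if x ∈ nearSet M S then 0.075 * (M : ℝ) ^ 2 * Metric.infDist x S ^ 2 else 0.0019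

lemma measurable_gap (M : ℕ) (S : Finset Torus) : Measurable (gap M S) := by
  unfold gap
  refine Measurable.ite (measurableSet_nearSet M S) ?_ measurable_const
  exact Continuous.measurable (by have := Metric.continuous_infDist_pt (S : Set Torus); fun_prop)

lemma gap_nonneg (M : ℕ) (S : Finset Torus) (x : Torus) : 0 ≤ gap M S x := by
  unfold gap
  split_ifs <;> positivity

lemma mem_nearSet_iff {x : Torus} : x ∈ nearSet M S ↔ ∃ s ∈ S, dist x s ≤ 0.16 / (M : ℝ) := by
  simp [nearSet, nearPoint]

lemma gap_eq_zero {s : Torus} (hs : s ∈ S) : gap M S s = 0 := by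
  rw [gap, if_pos (mem_nearSet_iff.2 ⟨s, hs, by rw [dist_self]; positivity⟩),
    Metric.infDist_zero_of_mem (Finset.mem_coe.2 hs)]
  simp

/-- Any other node is at distance at least 2/M - 0.16/M from x, so s is the nearest one. -/
lemma gap_of_mem_nearPoint (hsep : IsMinSeparated M (S : Set Torus)) {s x : Torus} (hs : s ∈ S)
    (hx : x ∈ nearPoint M s) : gap M S x = 0.075 * (M : ℝ) ^ 2 * dist x s ^ 2 := by
  have hx' : dist x s ≤ 0.16 / (M : ℝ) := hx
  rw [gap, if_pos (mem_nearSet_iff.2 ⟨s, hs, hx⟩)]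
  congr 2
  refine le_antisymm (Metric.infDist_le_dist_of_mem (Finset.mem_coe.2 hs))
    ((Metric.le_infDist ⟨s, Finset.mem_coe.2 hs⟩).2 fun t ht => ?_)
  rcases eq_or_ne s t with rfl | hst
  · exact le_rfl
  · have h1 := hsep s (Finset.mem_coe.2 hs) t ht hst
    have h2 := dist_triangle_left s t x
    have h3 : 0.16 / (M : ℝ) + 0.16 / M ≤ 2 / M := by rw [← add_div]; gcongr; norm_num
    linarith

lemma pairwiseDisjoint_nearPoint (hM : 0 < M) (hsep : IsMinSeparated M (S : Set Torus)) :
    Set.PairwiseDisjoint (S : Set Torus) (nearPoint M) := by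
  intro s hs t ht hst
  refine Set.disjoint_left.2 fun x hx hx' => ?_
  have h0 : dist x s ≤ 0.16 / (M : ℝ) := hx
  have h0' : dist x t ≤ 0.16 / (M : ℝ) := hx'
  have h1 := hsep s hs t ht hst
  have h2 := dist_triangle_left s t x
  have h3 : 0.16 / (M : ℝ) + 0.16 / M < 2 / M := by rw [← add_div]; gcongr; norm_num
  linarith

/-- Dual polynomials of degree `M` for data on a separated set. -/
lemma exists_trigSum_le_gap (hM : 128 ≤ M) (hsep : IsMinSeparated M (S : Set Torus))
    (v : Torus → ℂ) (hv : ∀ s, ‖v s‖ ≤ 1) :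
    ∃ c : ℤ → ℂ, (∀ s ∈ S, trigSum M c s = v s) ∧ ∀ x, ‖trigSum M c x‖ ≤ 1 - gap M S x := by
  obtain ⟨N, hN1, hN2⟩ : ∃ N : ℕ, 2 * N ≤ M + 1 ∧ M ≤ 2 * N := ⟨(M + 1) / 2, by omega, by omega⟩
  have hM0 : (0 : ℝ) < M := by exact_mod_cast (by omega : 0 < M)
  have hMN : (M : ℝ) ≤ 2 * N := by exact_mod_cast hN2
  have hsep' : ∀ s ∈ S, ∀ t ∈ S, s ≠ t → 1 ≤ N * ‖s - t‖ := fun s hs t ht hst => by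
    have h := hsep s hs t ht hst
    rw [dist_eq_norm, div_le_iff₀ hM0] at h
    nlinarith [norm_nonneg (s - t)]
  obtain ⟨q, hq, hqS, hnear, hfar⟩ := exists_dual_polynomial (by omega) hsep' v hv
  obtain ⟨c, rfl⟩ := exists_trigSum_of_mem (trigPoly_mono (by omega : 2 * N - 1 ≤ M) hq)
  refine ⟨c, hqS, fun x => ?_⟩
  by_cases hx : x ∈ nearSet M S
  · obtain ⟨s, hs, hxs⟩ := mem_nearSet_iff.1 hx
    rw [gap_of_mem_nearPoint hsep hs hxs]
    rw [le_div_iff₀ hM0] at hxs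
    have hNM : (2 : ℝ) * N ≤ M + 1 := by exact_mod_cast hN1
    have hM1 : (1 : ℝ) ≤ M := by exact_mod_cast (by omega : 1 ≤ M)
    rw [dist_eq_norm] at hxs ⊢
    refine (hnear s hs x ?_).trans ?_
    · nlinarith [norm_nonneg (x - s)]
    -- As M ≤ 2N, 0.3 N² ≥ 0.075 M².
    · have : (M * ‖x - s‖) ^ 2 ≤ (2 * N * ‖x - s‖) ^ 2 := by gcongr
      nlinarith
  · rw [gap, if_neg hx]
    by_cases hex : ∃ s ∈ S, N * ‖x - s‖ ≤ 1 / 4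
    · obtain ⟨s, hs, hxs⟩ := hex
      refine (hnear s hs x hxs).trans ?_
      have h1 : 0.16 / (M : ℝ) < ‖x - s‖ := by
        rw [← dist_eq_norm]
        by_contra hcon
        exact hx (mem_nearSet_iff.2 ⟨s, hs, not_lt.1 hcon⟩)
      rw [div_lt_iff₀ hM0] at h1
      -- Outside the 0.16/M neighbourhoods but still near a node, the quadratic gap is at least 0.3
      -- · 0.08² = 0.00192, whence the value 0.0019.
      have h2 : 0.08 ≤ N * ‖x - s‖ := by nlinarith [norm_nonneg (x - s)]
      have h3 : (0.08 : ℝ) ^ 2 ≤ (N * ‖x - s‖) ^ 2 := by gcongr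
      linarith
    · push Not at hex
      exact (hfar x fun s hs => (hex s hs).le).trans (by norm_num)

lemma integral_gap_le (hM : 128 ≤ M) {ε : ℝ} {μ₀ μ : ComplexMeasure Torus}
    (hsep : IsMinSeparated M (S : Set Torus)) (hS : (S : Set Torus) = support μ₀)
    (happ : IsApproximation ε M μ μ₀) :
    Integrable (gap M S) (μ - μ₀).variation ∧ ∫ x, gap M S x ∂(μ - μ₀).variation ≤ 4 * ε := by
  have hdual := exists_trigSum_le_gap hM hsep
  -- Any dual polynomial, here for zero data, gives 0 ≤ |q| ≤ 1 - gap.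
  have hle : ∀ x, gap M S x ≤ 1 := fun x => by
    obtain ⟨c, -, hc⟩ := hdual 0 (by simp)
    linarith [hc x, norm_nonneg (trigSum M c x)]
  refine ⟨Integrable.of_bound (measurable_gap M S).aestronglyMeasurable 1
    (Filter.Eventually.of_forall fun x => by
      rw [Real.norm_of_nonneg (gap_nonneg M S x)]; exact hle x), ?_⟩
  -- The gap vanishes on S, so removing S from the domain costs nothing.
  rw [← setIntegral_eq_integral_of_forall_compl_eq_zero (s := (S : Set Torus)ᶜ)]
  · exact setIntegral_le_of_dual hS happ (measurable_gap M S) (gap_nonneg M S) hdual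
  · intro x hx
    exact gap_eq_zero (by simpa using hx)

end Weight

end SuperResolution

/-! ### The two concentration estimates -/

theorem proposition2 :
    ∃ C : ℝ, 0 < C ∧
      ∀ (M : ℕ) (ε : ℝ) (μ₀ μ : MeasureTheory.ComplexMeasure SuperResolution.Torus)
        (S : Finset SuperResolution.Torus),
        128 ≤ M →
        μ₀ ∈ SuperResolution.separatedMeasures M →
        (S : Set SuperResolution.Torus) = SuperResolution.support μ₀ →
        SuperResolution.IsApproximation ε M μ μ₀ →
          (μ - μ₀).variation.real (SuperResolution.nearSet M S)ᶜ ≤ C * ε ∧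
          ∑ s ∈ S, ∫ x in SuperResolution.nearPoint M s, dist x s ^ 2 ∂(μ - μ₀).variation
            ≤ C * ((M : ℝ) ^ 2)⁻¹ * ε := by
  open SuperResolution in
  -- The first estimate needs 4/0.0019 < 2106, the second only 4/0.075 < 54; rounding up uses ε ≥ 0.
  refine ⟨2200, by norm_num, fun M ε μ₀ μ S hM hμ₀ hS happ => ?_⟩
  have hsep : IsMinSeparated M (S : Set Torus) := hS ▸ hμ₀.2
  have hM0 : (0 : ℝ) < M := by exact_mod_cast (by omega : 0 < M)
  have hε : 0 ≤ ε := by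
    have h : 0 ≤ l2Norm (proj M (μ - μ₀)) := ENNReal.toReal_nonneg
    linarith [happ.2]
  obtain ⟨hint, hle⟩ := integral_gap_le hM hsep hS happ
  have hset : ∀ A : Set Torus, ∫ x in A, gap M S x ∂(μ - μ₀).variation ≤ 4 * ε := fun A =>
    (setIntegral_le_integral hint (Filter.Eventually.of_forall (gap_nonneg M S))).trans hle
  constructor
  · have h := hset (nearSet M S)ᶜ
    have hconst : Set.EqOn (gap M S) (fun _ => (0.0019 : ℝ)) (nearSet M S)ᶜ :=
      fun x hx => if_neg hx
    rw [setIntegral_congr_fun (measurableSet_nearSet M S).compl hconst, setIntegral_const,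
      smul_eq_mul] at h
    linarith
  · have h := hset (nearSet M S)
    rw [nearSet, integral_biUnion_finset S (fun s _ => measurableSet_nearPoint M s)
      (pairwiseDisjoint_nearPoint (by omega) hsep) fun s _ => hint.integrableOn] at h
    have h2 : ∀ s ∈ S, ∫ x in nearPoint M s, gap M S x ∂(μ - μ₀).variation =
        0.075 * (M : ℝ) ^ 2 * ∫ x in nearPoint M s, dist x s ^ 2 ∂(μ - μ₀).variation := by
      intro s hs
      rw [← integral_const_mul]
      exact setIntegral_congr_fun (measurableSet_nearPoint M s)
        fun x hx => gap_of_mem_nearPoint hsep hs hx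
    rw [Finset.sum_congr rfl h2, ← Finset.mul_sum] at h
    rw [mul_right_comm, ← div_eq_mul_inv, le_div_iff₀ (by positivity)]
    linarith
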